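/- Let $S^1=\mathbb R/2\pi\mathbb Z$ and, for $\psi=\psi(t,x)$, write $\psi(t,x)=\sum_{k\in\mathbb Z}\hat\psi_k(t)e^{ikx}$. For $\varepsilon>0$ and a choice of sign $\pm$ consider the Cauchy problem $$ i\psi_t=-\psi_{xx}\pm 2\cos(2x)\,|\psi|^2\psi,\qquad \psi(0,x)=\varepsilon(\cos x+\sin x),\qquad x\in S^1. $$ There are constants $\varepsilon_0>0$ and $C$ such that for every $0<\varepsilon\le\varepsilon_0$ and for either sign the following holds. The problem has a solution $\psi\in C\big([-\varepsilon^{-9/4},\varepsilon^{-9/4}];H^1(S^1)\big)$ (the equation being understood in the sense of distributions on $S^1$, i.e. Fourier coefficient by Fourier coefficient), and for every interval $J\ni 0$, every solution $\psi\in C(J;H^1(S^1))$ of the problem (in particular the global one) and every $t\in J$ with $|t|\le\varepsilon^{-9/4}$, $$ \Big||\hat\psi_1(t)|^2+|\hat\psi_{-1}(t)|^2-\varepsilon^2\Big|\le C\varepsilon^3,\qquad \Big||\hat\psi_1(t)|^2-|\hat\psi_{-1}(t)|^2\mp\varepsilon^2\sin(2\varepsilon^2t)\Big|\le C\varepsilon^{9/4},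 $$ that is, $|\hat\psi_1|^2+|\hat\psi_{-1}|^2=\varepsilon^2+O(\varepsilon^3)$ and $|\hat\psi_1|^2-|\hat\psi_{-1}|^2=\pm\varepsilon^2\sin(2\varepsilon^2t)+O(\varepsilon^{9/4})$, uniformly for $|t|\le\varepsilon^{-9/4}$, with the sign of the nonlinearity. -/

import Mathlib

open scoped Topology Real

noncomputable section

namespace BeatingNLS

/-- The circle `S¹ = ℝ / 2πℤ`. Mathlib's `fourierCoeff` on it is taken with respect to the
normalized Lebesgue measure, so that `ψ = ∑ₖ (fourierCoeff ψ k) e^{ikx}`. -/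
abbrev Circ : Type := AddCircle (2 * π)

instance instFactTwoPiPos : Fact (0 < 2 * π) := ⟨Real.two_pi_pos⟩

/-- The function `2 cos 2x` on the circle. -/
def twoCosTwo : Circ → ℝ :=
  Function.Periodic.lift (f := fun x : ℝ => 2 * Real.cos (2 * x)) (c := 2 * π) (by
    intro x
    have h : 2 * (x + 2 * π) = 2 * x + 2 * π + 2 * π := by ring
    simp only [h, Real.cos_add_two_pi])

theorem twoCosTwo_coe (x : ℝ) : twoCosTwo (x : Circ) = 2 * Real.cos (2 * x) := rfl

/-- The nonlinearity `2 cos(2x) |u|² u`. -/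
def nonlin (u : Circ → ℂ) (x : Circ) : ℂ :=
  (twoCosTwo x : ℂ) * ((‖u x‖ ^ 2 : ℝ) : ℂ) * u x

/-- `u` belongs to the Sobolev space `H¹(S¹)` (whose elements are continuous functions). -/
def MemH1 (u : C(Circ, ℂ)) : Prop :=
  Summable fun k : ℤ => (1 + (k : ℝ) ^ 2) * ‖fourierCoeff u k‖ ^ 2

/-- The norm of `H¹(S¹)`. -/
def h1Norm (u : C(Circ, ℂ)) : ℝ :=
  Real.sqrt (∑' k : ℤ, (1 + (k : ℝ) ^ 2) * ‖fourierCoeff u k‖ ^ 2)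

/-- `ψ` is a solution on the time interval `J`, of class `C(J; H¹(S¹))`, of the Cauchy problem
`i ψ_t = -ψ_xx + σ 2 cos(2x) |ψ|² ψ`, `ψ(0, x) = ε (cos x + sin x)`.
The equation is understood in the sense of distributions on the circle, that is, after testing
against every exponential `e^{-ikx}`. Values of `ψ` at times outside `J` play no role. -/
structure IsSolutionOn (J : Set ℝ) (σ ε : ℝ) (ψ : ℝ → C(Circ, ℂ)) : Prop where
  memH1 : ∀ t ∈ J, MemH1 (ψ t)
  continuous : ∀ t ∈ J, Filter.Tendsto (fun s => h1Norm (ψ s - ψ t)) (𝓝[J] t) (𝓝 0)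
  equation : ∀ t ∈ J, ∀ k : ℤ,
    ∃ d : ℂ, HasDerivWithinAt (fun s => fourierCoeff (ψ s) k) d J t ∧
      Complex.I * d = (k : ℂ) ^ 2 * fourierCoeff (ψ t) k
        + (σ : ℂ) * fourierCoeff (nonlin (ψ t)) k
  initial : ∀ x : ℝ, ψ 0 (x : Circ) = ((ε * (Real.cos x + Real.sin x) : ℝ) : ℂ)

end BeatingNLS

end

/-!
Beating between the modes `±1` of the Schrödinger equation with potential `2 cos 2x` in front of
the cubic nonlinearity.

No normal form is needed: the modes `k ≠ ±1` are controlled for all times by two conservation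
laws and a symmetry. Mass `∑ |ψ̂_k|²` and energy `∑ (1 + k²) |ψ̂_k|² + σ P(ψ)`, with
`P(ψ) = ½ ∫ 2 cos(2x) |ψ|⁴`, are conserved (`IsCurve.mass_eq`, `IsCurve.energy_eq`), and
`|P(ψ)| ≲ ‖ψ‖²_{H¹} ‖ψ‖²_{L²}`. Hence `‖ψ(t)‖_{H¹} ≤ 2ε` (`IsCurve.norm_sq_le`), so that
`∑ (k² - 1) |ψ̂_k|² = O(ε⁴)`. The equation commutes with `u ↦ -u(· + π)`, which fixes the initial
datum; by uniqueness only odd modes occur (`IsCurve.even_modes_eq_zero`). The mode `k = 0`, the only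
one for which `k² - 1` is negative, is therefore absent, and the part of `ψ` outside the modes `±1`
is `O(ε²)` in `H¹` (`IsCurve.offPart_le`). Together with conservation of mass this is the first
estimate.

For the second one, let `p`, `q` be the modes `±1` and `m = |p|² + |q|²`. Up to `O(ε⁴)` they solve
`i p' = σ (2 Re(p q̄) p + m q)` and `i q' = σ (2 Re(p q̄) q + m p)`, whence
`ζ = 2 Im(p̄ q) + iσ(|p|² - |q|²)` (`rotor`) satisfies `ζ' = 2imζ + O(ε⁵) = 2iε²ζ + O(ε⁵)`. As
`ζ(0) = ε²`, this gives `ζ = ε² e^{2iε²t} + O(ε⁵ |t|)` (`IsCurve.diff_modes`), and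
`ε⁵ |t| ≤ ε^{11/4}` for `|t| ≤ ε^{-9/4}`.

Functions in `H¹` are encoded by their weighted Fourier coefficients `x_k = ⟨k⟩ ψ̂_k`, a point of
the Hilbert space `ℓ²(ℤ)` with `‖x‖ = ‖ψ‖_{H¹}`; `synth` recovers the function. In the interaction
picture `v_k = e^{ik²t} x_k` the equation becomes an ordinary differential equation in `ℓ²(ℤ)` with
a locally Lipschitz right-hand side, and every solution of class `C(J; H¹)` is continuously
differentiable there (`IsSolutionOn.isCurve`). Existence up to any time (`exists_isCurve`) follows
from the Picard–Lindelöf theorem for the equation truncated outside a ball, because the a priori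
bound keeps the solution in the region where the truncation is inactive.
-/

noncomputable section

namespace BeatingNLS

open Filter MeasureTheory AddCircle Set
open ComplexConjugate

/-! ### Weighted coefficient sequences, multipliers and convolution -/

/-- The Hilbert space `ℓ²(ℤ)`. -/
abbrev HSeq : Type := lp (fun _ : ℤ => ℂ) 2

theorem memℓp_two_iff {f : ℤ → ℂ} : Memℓp f 2 ↔ Summable fun k => ‖f k‖ ^ 2 := by
  rw [memℓp_gen_iff (by norm_num)]
  simp

theorem HSeq.hasSum_norm_sq (x : HSeq) : HasSum (fun k => ‖x k‖ ^ 2) (‖x‖ ^ 2) := by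
  simpa using lp.hasSum_norm (p := 2) (by norm_num) x

/-- The Japanese bracket `⟨k⟩ = √(1 + k²)`. -/
def bracket (k : ℤ) : ℝ := Real.sqrt (1 + (k : ℝ) ^ 2)

theorem bracket_sq (k : ℤ) : bracket k ^ 2 = 1 + (k : ℝ) ^ 2 := Real.sq_sqrt (by positivity)

theorem bracket_pos (k : ℤ) : 0 < bracket k := Real.sqrt_pos.2 (by positivity)

theorem one_le_bracket (k : ℤ) : 1 ≤ bracket k := by
  rw [bracket, Real.one_le_sqrt]; nlinarith [sq_nonneg (k : ℝ)]

theorem bracket_ne_zero (k : ℤ) : (bracket k : ℂ) ≠ 0 := by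
  exact_mod_cast (bracket_pos k).ne'

theorem abs_le_bracket (k : ℤ) : |(k : ℝ)| ≤ bracket k :=
  Real.le_sqrt_of_sq_le (by rw [sq_abs]; linarith)

/-- The Fourier multiplier with a symbol `m` bounded by one. -/
def mult (m : ℤ → ℂ) (hm : ∀ k, ‖m k‖ ≤ 1) : HSeq →L[ℂ] HSeq :=
  LinearMap.mkContinuous
    { toFun := fun x => ⟨fun k => m k * x k, (lp.memℓp x).mono' (fun k => by
        simpa using mul_le_of_le_one_left (norm_nonneg (x k)) (hm k))⟩
      map_add' := fun x y => by ext k; exact mul_add (m k) (x k) (y k)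
      map_smul' := fun c x => by ext k; simp [mul_left_comm] } 1 (fun x => by
    rw [one_mul]
    refine lp.norm_mono (by norm_num) fun k => ?_
    simpa using mul_le_of_le_one_left (norm_nonneg (x k)) (hm k))

@[simp] theorem mult_apply (m : ℤ → ℂ) (hm : ∀ k, ‖m k‖ ≤ 1) (x : HSeq) (k : ℤ) :
    mult m hm x k = m k * x k := rfl

theorem norm_mult_le (m : ℤ → ℂ) (hm : ∀ k, ‖m k‖ ≤ 1) (x : HSeq) : ‖mult m hm x‖ ≤ ‖x‖ := by
  refine lp.norm_mono (by norm_num) fun k => ?_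
  simpa using mul_le_of_le_one_left (norm_nonneg (x k)) (hm k)

/-- Pointwise convergence of uniformly bounded symbols implies strong convergence of the
multipliers. -/
theorem tendsto_mult {ι : Type*} {l : Filter ι} [l.IsCountablyGenerated] {m : ι → ℤ → ℂ}
    (hm : ∀ i k, ‖m i k‖ ≤ 1) {m' : ℤ → ℂ} (hm' : ∀ k, ‖m' k‖ ≤ 1)
    (h : ∀ k, Tendsto (fun i => m i k) l (𝓝 (m' k))) (x : HSeq) :
    Tendsto (fun i => mult (m i) (hm i) x) l (𝓝 (mult m' hm' x)) := by
  rw [tendsto_iff_norm_sub_tendsto_zero]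
  have key : Tendsto (fun i => ∑' k, ‖(mult (m i) (hm i) x - mult m' hm' x) k‖ ^ 2) l
      (𝓝 (∑' _ : ℤ, (0 : ℝ))) := by
    refine tendsto_tsum_of_dominated_convergence (bound := fun k => 4 * ‖x k‖ ^ 2)
      (x.hasSum_norm_sq.summable.mul_left 4) (fun k => ?_) (Eventually.of_forall fun i k => ?_)
    · have h1 : Tendsto (fun i => ‖m i k * x k - m' k * x k‖ ^ 2) l
          (𝓝 (‖m' k * x k - m' k * x k‖ ^ 2)) :=
        ((((h k).mul_const (x k)).sub_const _).norm).pow 2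
      simpa using h1
    · have h1 : ‖(mult (m i) (hm i) x - mult m' hm' x) k‖ ≤ 2 * ‖x k‖ := by
        have : (mult (m i) (hm i) x - mult m' hm' x) k = (m i k - m' k) * x k := by
          simp [sub_mul]
        rw [this, norm_mul]
        gcongr
        exact (norm_sub_le _ _).trans (by linarith [hm i k, hm' k])
      rw [norm_pow, norm_norm]
      calc _ ≤ (2 * ‖x k‖) ^ 2 := by gcongr
        _ = _ := by ring
  rw [tsum_zero] at key
  have h2 : ∀ i, ‖mult (m i) (hm i) x - mult m' hm' x‖
      = Real.sqrt (∑' k, ‖(mult (m i) (hm i) x - mult m' hm' x) k‖ ^ 2) := fun i => by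
    rw [(HSeq.hasSum_norm_sq _).tsum_eq, Real.sqrt_sq (norm_nonneg _)]
  simp_rw [h2]
  simpa using key.sqrt

/-- The multiplier `⟨k⟩⁻¹`. It turns the weighted coefficients `⟨k⟩ û_k` of an `H¹` function into
the coefficients `û_k`. -/
def unweight : HSeq →L[ℂ] HSeq := mult (fun k => ((bracket k)⁻¹ : ℝ)) (fun k => by
  rw [Complex.norm_real, Real.norm_of_nonneg (inv_nonneg.2 (bracket_pos k).le)]
  exact inv_le_one_of_one_le₀ (one_le_bracket k))

@[simp] theorem unweight_apply (x : HSeq) (k : ℤ) : unweight x k = ((bracket k)⁻¹ : ℝ) * x k := rfl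

/-- The multiplier `k ⟨k⟩⁻¹`. It turns the weighted coefficients `⟨k⟩ û_k` of an `H¹` function
into the coefficients `k û_k` of its derivative (up to a factor `i`). -/
def derivMult : HSeq →L[ℂ] HSeq := mult (fun k => ((k / bracket k : ℝ) : ℂ)) (fun k => by
  rw [Complex.norm_real, norm_div, Real.norm_eq_abs, Real.norm_of_nonneg (bracket_pos k).le]
  exact div_le_one_of_le₀ (abs_le_bracket k) (bracket_pos k).le)

@[simp] theorem derivMult_apply (x : HSeq) (k : ℤ) :
    derivMult x k = ((k / bracket k : ℝ) : ℂ) * x k := rfl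

theorem norm_unweight_le (x : HSeq) : ‖unweight x‖ ≤ ‖x‖ := norm_mult_le _ _ x

theorem norm_derivMult_le (x : HSeq) : ‖derivMult x‖ ≤ ‖x‖ := norm_mult_le _ _ x

/-- The free Schrödinger group, with the sign for which `freeFlow t` undoes the linear evolution:
multiplication of the `k`-th coefficient by `e^{ik²t}`. -/
def freeFlow (t : ℝ) : HSeq →L[ℂ] HSeq :=
  mult (fun k => Complex.exp ((k ^ 2 * t : ℝ) * Complex.I)) (fun k => by
    rw [Complex.norm_exp_ofReal_mul_I])

@[simp] theorem freeFlow_apply (t : ℝ) (x : HSeq) (k : ℤ) :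
    freeFlow t x k = Complex.exp ((k ^ 2 * t : ℝ) * Complex.I) * x k := rfl

theorem freeFlow_freeFlow (s t : ℝ) (x : HSeq) :
    freeFlow s (freeFlow t x) = freeFlow (s + t) x := by
  ext k
  simp only [freeFlow_apply, ← mul_assoc, ← Complex.exp_add]
  congr 2
  push_cast; ring

@[simp] theorem freeFlow_zero (x : HSeq) : freeFlow 0 x = x := by
  ext k; simp

@[simp] theorem norm_freeFlow (t : ℝ) (x : HSeq) : ‖freeFlow t x‖ = ‖x‖ := by
  refine le_antisymm (norm_mult_le _ _ x) ?_
  calc ‖x‖ = ‖freeFlow (-t) (freeFlow t x)‖ := by rw [freeFlow_freeFlow]; simp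
    _ ≤ _ := norm_mult_le _ _ _

/-- The free group is strongly continuous; being isometric, it is jointly continuous. -/
theorem continuous_freeFlow : Continuous fun p : ℝ × HSeq => freeFlow p.1 p.2 := by
  rw [continuous_iff_continuousAt]
  rintro ⟨t, x⟩
  have h1 : Tendsto (fun s : ℝ => freeFlow s x) (𝓝 t) (𝓝 (freeFlow t x)) := by
    refine tendsto_mult _ _ (fun k => ?_) x
    exact Continuous.tendsto (by fun_prop) t
  have h2 : Tendsto (fun p : ℝ × HSeq => freeFlow p.1 x) (𝓝 (t, x)) (𝓝 (freeFlow t x)) :=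
    h1.comp continuous_fst.continuousAt
  have h3 : Tendsto (fun p : ℝ × HSeq => freeFlow p.1 (p.2 - x)) (𝓝 (t, x)) (𝓝 0) := by
    rw [tendsto_zero_iff_norm_tendsto_zero]
    simp only [norm_freeFlow]
    have : Tendsto (fun p : ℝ × HSeq => ‖p.2 - x‖) (𝓝 (t, x)) (𝓝 ‖x - x‖) :=
      Continuous.tendsto (by fun_prop) (t, x)
    simpa using this
  have h4 := h2.add h3
  rw [add_zero] at h4
  refine h4.congr fun p => ?_
  simp

/-- The translation `u ↦ u(· + π)`, which multiplies the `k`-th coefficient by `(-1)^k`. -/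
def halfShift : HSeq →L[ℂ] HSeq := mult (fun k => (((-1 : ℤˣ) ^ k : ℤˣ) : ℤ)) (fun k => by
  rcases Int.units_eq_one_or ((-1 : ℤˣ) ^ k) with h | h <;> simp [h])

@[simp] theorem halfShift_apply (x : HSeq) (k : ℤ) :
    halfShift x k = ((((-1 : ℤˣ) ^ k : ℤˣ) : ℤ) : ℂ) * x k := rfl

theorem summable_one_add_sq_inv : Summable fun k : ℤ => (1 + (k : ℝ) ^ 2)⁻¹ := by
  refine Summable.of_norm_bounded_eventually (g := fun k : ℤ => 1 / (k : ℝ) ^ 2)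
    (Real.summable_one_div_int_pow.2 (by norm_num)) ?_
  filter_upwards [(Set.finite_singleton (0 : ℤ)).compl_mem_cofinite] with k hk
  have hk' : (0 : ℝ) < (k : ℝ) ^ 2 := by
    have : (k : ℝ) ≠ 0 := by exact_mod_cast hk
    positivity
  rw [Real.norm_of_nonneg (by positivity), one_div]
  exact inv_anti₀ hk' (by linarith)

/-- The sequence `⟨k⟩⁻¹`. -/
def invBracket : HSeq := ⟨fun k => ((bracket k)⁻¹ : ℝ), memℓp_two_iff.2 (by
  refine summable_one_add_sq_inv.congr fun k => ?_
  rw [Complex.norm_real, Real.norm_of_nonneg (inv_nonneg.2 (bracket_pos k).le), inv_pow,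
    bracket_sq])⟩

/-- The constant `‖⟨k⟩⁻¹‖_{ℓ²}` of the embedding of `H¹` into the functions with absolutely summable
Fourier coefficients, and hence into the continuous functions. -/
def embConst : ℝ := ‖invBracket‖

theorem embConst_nonneg : 0 ≤ embConst := norm_nonneg _

theorem summable_unweight (x : HSeq) : Summable fun k => ‖unweight x k‖ := by
  refine (lp.summable_mul (p := 2) (q := 2) ?_ invBracket x).congr fun k => ?_
  · simpa using Real.HolderConjugate.two_two
  · rw [unweight_apply, norm_mul]; rfl

theorem tsum_unweight_le (x : HSeq) : ∑' k, ‖unweight x k‖ ≤ embConst * ‖x‖ := by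
  refine le_of_eq_of_le ?_ (lp.tsum_mul_le_mul_norm' (p := 2) (q := 2) ?_ invBracket x)
  · refine tsum_congr fun k => ?_
    rw [unweight_apply, norm_mul]; rfl
  · simpa using Real.HolderConjugate.two_two

theorem hasSum_norm_sq_translate (x : HSeq) (j : ℤ) :
    HasSum (fun k => ‖x (k - j)‖ ^ 2) (‖x‖ ^ 2) :=
  (Equiv.subRight j).hasSum_iff (f := fun k => ‖x k‖ ^ 2) |>.2 x.hasSum_norm_sq

/-- Translation of the index by `j`: multiplication by `e^{ijx}` of an `L²` function given by its
unweighted coefficients. -/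
def shiftₗ (j : ℤ) : HSeq →ₗ[ℂ] HSeq where
  toFun x := ⟨fun k => x (k - j), memℓp_two_iff.2 (hasSum_norm_sq_translate x j).summable⟩
  map_add' _ _ := rfl
  map_smul' _ _ := rfl

theorem norm_shiftₗ (j : ℤ) (x : HSeq) : ‖shiftₗ j x‖ = ‖x‖ := by
  have h : ‖shiftₗ j x‖ ^ 2 = ‖x‖ ^ 2 :=
    (HSeq.hasSum_norm_sq (shiftₗ j x)).unique (hasSum_norm_sq_translate x j)
  exact (pow_left_inj₀ (norm_nonneg _) (norm_nonneg _) two_ne_zero).1 h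

/-- The translation of the index by `j` as a continuous linear map. -/
def shift (j : ℤ) : HSeq →L[ℂ] HSeq :=
  (shiftₗ j).mkContinuous 1 (fun x => by rw [one_mul, norm_shiftₗ])

@[simp] theorem shift_apply (j k : ℤ) (x : HSeq) : shift j x k = x (k - j) := rfl

theorem norm_shift_le (j : ℤ) : ‖shift j‖ ≤ 1 := LinearMap.mkContinuous_norm_le _ zero_le_one _

theorem norm_smul_shift_le (x : HSeq) (j : ℤ) : ‖unweight x j • shift j‖ ≤ ‖unweight x j‖ := by
  rw [norm_smul]
  exact mul_le_of_le_one_right (norm_nonneg _) (norm_shift_le j)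

theorem summable_smul_shift (x : HSeq) : Summable fun j => unweight x j • shift j :=
  (summable_unweight x).of_norm_bounded (norm_smul_shift_le x)

/-- The convolution `(x, y) ↦ ∑ⱼ ⟨j⟩⁻¹ xⱼ y_{k-j}`: the product of the function with weighted
coefficients `x` and of the `L²` function with coefficients `y`. -/
def conv : HSeq →L[ℂ] HSeq →L[ℂ] HSeq :=
  LinearMap.mkContinuous
    { toFun := fun x => ∑' j, unweight x j • shift j
      map_add' := fun x y => by
        rw [← (summable_smul_shift x).tsum_add (summable_smul_shift y)]
        refine tsum_congr fun j => ?_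
        rw [map_add, lp.coeFn_add, Pi.add_apply, add_smul]
      map_smul' := fun c x => by
        rw [RingHom.id_apply, ← (summable_smul_shift x).tsum_const_smul c]
        refine tsum_congr fun j => ?_
        rw [map_smul, lp.coeFn_smul, Pi.smul_apply, smul_assoc] } embConst (fun x =>
    (tsum_of_norm_bounded (summable_unweight x).hasSum (norm_smul_shift_le x)).trans
      (tsum_unweight_le x))

theorem conv_eq_tsum (x : HSeq) : conv x = ∑' j, unweight x j • shift j := rfl

theorem norm_conv_le (x y : HSeq) : ‖conv x y‖ ≤ embConst * ‖x‖ * ‖y‖ := by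
  refine (conv x).le_of_opNorm_le ?_ y
  rw [conv_eq_tsum]
  exact (tsum_of_norm_bounded (summable_unweight x).hasSum (norm_smul_shift_le x)).trans
    (tsum_unweight_le x)

theorem hasSum_conv (x y : HSeq) (k : ℤ) :
    HasSum (fun j => unweight x j * y (k - j)) (conv x y k) := by
  have h1 : HasSum (fun j => unweight x j • shift j) (conv x) := (summable_smul_shift x).hasSum
  have h2 := (lp.evalCLM ℂ (fun _ : ℤ => ℂ) 2 k).hasSum
    ((ContinuousLinearMap.apply ℂ HSeq y).hasSum h1)
  have h3 (z : HSeq) : lp.evalCLM ℂ (fun _ : ℤ => ℂ) 2 k z = z k := rfl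
  simp only [h3, ContinuousLinearMap.apply_apply, _root_.smul_apply,
    lp.coeFn_smul, Pi.smul_apply, smul_eq_mul, shift_apply] at h2
  exact h2

-- From here on only the coordinate formulas are used; unfolding would slow down unification.
attribute [irreducible] mult unweight derivMult freeFlow halfShift shift conv

/-! ### The algebra `H¹` and the cubic nonlinearity -/

/-- The sequence of Fourier coefficients of a continuous function, as an element of `ℓ²(ℤ)`. -/
def l2Coeff : C(Circ, ℂ) →L[ℂ] HSeq :=
  (fourierBasis (T := 2 * π)).repr.toContinuousLinearEquiv.toContinuousLinearMap.comp
    (ContinuousMap.toLp 2 haarAddCircle ℂ)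

@[simp] theorem l2Coeff_apply (f : C(Circ, ℂ)) (k : ℤ) : l2Coeff f k = fourierCoeff f k :=
  (fourierBasis_repr _ k).trans (fourierCoeff_toLp f k)

theorem l2Coeff_injective : Function.Injective l2Coeff := fun f g h => by
  have h1 : ContinuousMap.toLp (E := ℂ) 2 haarAddCircle ℂ f
      = ContinuousMap.toLp (E := ℂ) 2 haarAddCircle ℂ g :=
    (fourierBasis (T := 2 * π)).repr.injective h
  exact ContinuousMap.toLp_injective (𝕜 := ℂ) haarAddCircle h1

theorem inner_l2Coeff (f g : C(Circ, ℂ)) :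
    inner ℂ (l2Coeff f) (l2Coeff g) = ∫ x, g x * (starRingEnd ℂ) (f x) ∂haarAddCircle := by
  rw [← ContinuousMap.inner_toLp]
  exact (fourierBasis (T := 2 * π)).repr.inner_map_map _ _

theorem fourierCoeff_fourier_mul (j k : ℤ) (g : C(Circ, ℂ)) :
    fourierCoeff (fourier j * g : C(Circ, ℂ)) k = fourierCoeff g (k - j) := by
  unfold fourierCoeff
  refine integral_congr_ae (Eventually.of_forall fun x => ?_)
  simp only [ContinuousMap.mul_apply, smul_eq_mul]
  rw [← mul_assoc, ← fourier_add]
  congr 3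
  ring

theorem fourierCoeff_star (f : C(Circ, ℂ)) (k : ℤ) :
    fourierCoeff (star f : C(Circ, ℂ)) k = (starRingEnd ℂ) (fourierCoeff f (-k)) := by
  unfold fourierCoeff
  rw [← integral_conj]
  refine integral_congr_ae (Eventually.of_forall fun x => ?_)
  simp

theorem summable_smul_fourier (x : HSeq) :
    Summable fun k => unweight x k • (fourier k : C(Circ, ℂ)) :=
  (summable_unweight x).of_norm_bounded fun k => by rw [norm_smul, fourier_norm, mul_one]

/-- The function `∑ₖ ⟨k⟩⁻¹ xₖ e^{ikx}` with weighted Fourier coefficients `x`. The map is an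
isometry from `ℓ²(ℤ)` onto `H¹`. -/
def synth : HSeq →L[ℂ] C(Circ, ℂ) :=
  LinearMap.mkContinuous
    { toFun := fun x => ∑' k, unweight x k • (fourier k : C(Circ, ℂ))
      map_add' := fun x y => by
        rw [← (summable_smul_fourier x).tsum_add (summable_smul_fourier y)]
        refine tsum_congr fun j => ?_
        rw [map_add, lp.coeFn_add, Pi.add_apply, add_smul]
      map_smul' := fun c x => by
        rw [RingHom.id_apply, ← (summable_smul_fourier x).tsum_const_smul c]
        refine tsum_congr fun j => ?_
        rw [map_smul, lp.coeFn_smul, Pi.smul_apply, smul_assoc] } embConst (fun x =>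
    (tsum_of_norm_bounded (summable_unweight x).hasSum
      (fun k => by rw [norm_smul, fourier_norm, mul_one])).trans (tsum_unweight_le x))

theorem hasSum_synth (x : HSeq) :
    HasSum (fun k => unweight x k • (fourier k : C(Circ, ℂ))) (synth x) :=
  (summable_smul_fourier x).hasSum

theorem norm_synth_le (x : HSeq) : ‖synth x‖ ≤ embConst * ‖x‖ :=
  synth.le_of_opNorm_le (LinearMap.mkContinuous_norm_le _ embConst_nonneg _) x

theorem fourierCoeff_synth (x : HSeq) (k : ℤ) : fourierCoeff (synth x) k = unweight x k := by
  have h := ((lp.evalCLM ℂ (fun _ : ℤ => ℂ) 2 k).comp l2Coeff).hasSum (hasSum_synth x)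
  have h3 (z : HSeq) : lp.evalCLM ℂ (fun _ : ℤ => ℂ) 2 k z = z k := rfl
  simp only [ContinuousLinearMap.comp_apply, h3, map_smul, l2Coeff_apply, fourierCoeff_fourier,
    smul_eq_mul] at h
  refine h.unique ?_
  have h4 : HasSum (fun j => unweight x j * (Pi.single j 1 : ℤ → ℂ) k)
      (unweight x k * (Pi.single k 1 : ℤ → ℂ) k) :=
    hasSum_single k fun j hj => by rw [Pi.single_eq_of_ne hj.symm, mul_zero]
  rwa [Pi.single_eq_same, mul_one] at h4

@[simp] theorem l2Coeff_synth (x : HSeq) : l2Coeff (synth x) = unweight x := by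
  ext k; rw [l2Coeff_apply, fourierCoeff_synth]

theorem unweight_norm_sq (x : HSeq) (k : ℤ) :
    (1 + (k : ℝ) ^ 2) * ‖unweight x k‖ ^ 2 = ‖x k‖ ^ 2 := by
  rw [unweight_apply, norm_mul, Complex.norm_real,
    Real.norm_of_nonneg (inv_nonneg.2 (bracket_pos k).le), mul_pow, ← bracket_sq, ← mul_assoc,
    ← mul_pow, mul_inv_cancel₀ (bracket_pos k).ne', one_pow, one_mul]

theorem memH1_synth (x : HSeq) : MemH1 (synth x) := by
  refine x.hasSum_norm_sq.summable.congr fun k => ?_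
  rw [fourierCoeff_synth, unweight_norm_sq]

theorem h1Norm_synth (x : HSeq) : h1Norm (synth x) = ‖x‖ := by
  rw [h1Norm, ← Real.sqrt_sq (norm_nonneg x), ← x.hasSum_norm_sq.tsum_eq]
  congr 1
  refine tsum_congr fun k => ?_
  rw [fourierCoeff_synth, unweight_norm_sq]

open Classical in
/-- The weighted Fourier coefficients `⟨k⟩ û_k` of `u ∈ H¹` (and `0` if `u ∉ H¹`). -/
def wcoeff (u : C(Circ, ℂ)) : HSeq :=
  if h : MemH1 u then ⟨fun k => bracket k * fourierCoeff u k, memℓp_two_iff.2 (by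
    refine h.congr fun k => ?_
    rw [norm_mul, mul_pow, Complex.norm_real, Real.norm_of_nonneg (bracket_pos k).le,
      bracket_sq])⟩ else 0

theorem synth_wcoeff {u : C(Circ, ℂ)} (h : MemH1 u) : synth (wcoeff u) = u := by
  refine l2Coeff_injective ?_
  ext k
  rw [l2Coeff_synth, wcoeff, dif_pos h, l2Coeff_apply, unweight_apply]
  push_cast
  exact inv_mul_cancel_left₀ (bracket_ne_zero k) _

theorem unweight_injective : Function.Injective unweight := fun x y h => by
  ext k
  have := congrArg (fun z : HSeq => z k) h
  simp only [unweight_apply] at this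
  exact mul_left_cancel₀ (by exact_mod_cast (inv_pos.2 (bracket_pos k)).ne') this

theorem synth_injective : Function.Injective synth := fun x y h => by
  apply unweight_injective
  rw [← l2Coeff_synth, h, l2Coeff_synth]

@[simp] theorem wcoeff_synth (x : HSeq) : wcoeff (synth x) = x :=
  synth_injective (synth_wcoeff (memH1_synth x))

/-- The product of `H¹`, transported to weighted Fourier coefficients. The two summands of
`⟨k⟩ = ⟨k⟩⁻¹ + k⟨k⟩⁻¹ k` are applied to `uv` and, by the Leibniz rule, to `u'v + uv'`. -/
def mulX (x y : HSeq) : HSeq :=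
  unweight (conv x (unweight y)) + derivMult (conv y (derivMult x) + conv x (derivMult y))

@[fun_prop]
theorem continuous_mulX {α : Type*} [TopologicalSpace α] {f g : α → HSeq} (hf : Continuous f)
    (hg : Continuous g) : Continuous fun a => mulX (f a) (g a) := by
  unfold mulX
  fun_prop

theorem mulX_sub_left (x y z : HSeq) : mulX (x - y) z = mulX x z - mulX y z := by
  simp only [mulX, map_sub, _root_.sub_apply, map_add]
  abel

theorem mulX_sub_right (x y z : HSeq) : mulX x (y - z) = mulX x y - mulX x z := by
  simp only [mulX, map_sub, _root_.sub_apply, map_add]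
  abel

theorem norm_mulX_le (x y : HSeq) : ‖mulX x y‖ ≤ 3 * embConst * ‖x‖ * ‖y‖ := by
  have h1 : ‖unweight (conv x (unweight y))‖ ≤ embConst * ‖x‖ * ‖y‖ :=
    (norm_unweight_le _).trans ((norm_conv_le _ _).trans
      (mul_le_mul_of_nonneg_left (norm_unweight_le y)
        (mul_nonneg embConst_nonneg (norm_nonneg _))))
  have h2 : ‖conv y (derivMult x)‖ ≤ embConst * ‖y‖ * ‖x‖ :=
    (norm_conv_le _ _).trans (mul_le_mul_of_nonneg_left (norm_derivMult_le x)
        (mul_nonneg embConst_nonneg (norm_nonneg _)))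
  have h3 : ‖conv x (derivMult y)‖ ≤ embConst * ‖x‖ * ‖y‖ :=
    (norm_conv_le _ _).trans (mul_le_mul_of_nonneg_left (norm_derivMult_le y)
        (mul_nonneg embConst_nonneg (norm_nonneg _)))
  have h4 := norm_add_le (unweight (conv x (unweight y)))
    (derivMult (conv y (derivMult x) + conv x (derivMult y)))
  have h5 := norm_derivMult_le (conv y (derivMult x) + conv x (derivMult y))
  have h6 := norm_add_le (conv y (derivMult x)) (conv x (derivMult y))
  rw [mulX]
  linarith

theorem derivMult_eq (x : HSeq) (k : ℤ) : derivMult x k = k * unweight x k := by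
  rw [derivMult_apply, unweight_apply]; push_cast; ring

/-- The Fourier coefficients of a product are the convolution of those of the factors: with
`a` their convolution, `⟨k⟩⁻¹ a + k⟨k⟩⁻¹ (k a) = ⟨k⟩ a`. -/
theorem hasSum_unweight_mulX (x y : HSeq) (k : ℤ) :
    HasSum (fun j => unweight x j * unweight y (k - j)) (unweight (mulX x y) k) := by
  have h1 := hasSum_conv x (unweight y) k
  have h2 : HasSum (fun j : ℤ => (j : ℂ) * (unweight x j * unweight y (k - j)))
      (conv y (derivMult x) k) := by
    convert! (Equiv.subLeft k).hasSum_iff.2 (hasSum_conv y (derivMult x) k) using 1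
    ext j
    simp only [Function.comp_apply, Equiv.subLeft_apply, derivMult_eq, sub_sub_cancel]
    ring
  have h3 := hasSum_conv x (derivMult y) k
  have h4 : conv y (derivMult x) k + conv x (derivMult y) k = k * conv x (unweight y) k := by
    refine (h2.add h3).unique ?_
    convert! h1.mul_left (k : ℂ) using 1
    ext j
    rw [derivMult_eq]
    push_cast
    ring
  convert! h1 using 1
  have hb : (bracket k : ℂ) ^ 2 = 1 + (k : ℂ) ^ 2 := by exact_mod_cast bracket_sq k
  have hb0 := bracket_ne_zero k
  rw [mulX, unweight_apply, lp.coeFn_add, Pi.add_apply, unweight_apply, derivMult_apply,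
    lp.coeFn_add, Pi.add_apply, h4]
  push_cast
  field_simp
  rw [hb, mul_comm]

theorem synth_mulX (x y : HSeq) : synth (mulX x y) = synth x * synth y := by
  refine l2Coeff_injective ?_
  ext k
  rw [l2Coeff_synth]
  refine (hasSum_unweight_mulX x y k).unique ?_
  have h := ((lp.evalCLM ℂ (fun _ : ℤ => ℂ) 2 k).comp l2Coeff).hasSum
    ((hasSum_synth x).mul_right (synth y))
  have h3 (z : HSeq) : lp.evalCLM ℂ (fun _ : ℤ => ℂ) 2 k z = z k := rfl
  simp only [ContinuousLinearMap.comp_apply, h3, smul_mul_assoc, map_smul, l2Coeff_apply,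
    fourierCoeff_fourier_mul, smul_eq_mul, fourierCoeff_synth] at h
  rw [l2Coeff_apply]
  exact h

/-- Complex conjugation of `H¹`, on weighted Fourier coefficients. -/
def starX : HSeq →ₗᵢ⋆[ℂ] HSeq where
  toFun x := ⟨fun k => (starRingEnd ℂ) (x (-k)), memℓp_two_iff.2 (by
    simpa [Function.comp_def] using (Equiv.neg ℤ).summable_iff.2 x.hasSum_norm_sq.summable)⟩
  map_add' x y := by ext k; exact map_add (starRingEnd ℂ) _ _
  map_smul' c x := by ext k; exact map_mul (starRingEnd ℂ) _ _
  norm_map' x := by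
    refine (pow_left_inj₀ (norm_nonneg _) (norm_nonneg _) two_ne_zero).1 ?_
    refine (HSeq.hasSum_norm_sq _).unique ?_
    have := (Equiv.neg ℤ).hasSum_iff.2 x.hasSum_norm_sq
    simpa [Function.comp_def] using this

@[simp] theorem starX_apply (x : HSeq) (k : ℤ) : starX x k = (starRingEnd ℂ) (x (-k)) := rfl

theorem unweight_starX (x : HSeq) (k : ℤ) :
    unweight (starX x) k = (starRingEnd ℂ) (unweight x (-k)) := by
  simp [unweight_apply, bracket]

theorem synth_starX (x : HSeq) : synth (starX x) = star (synth x) := by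
  refine l2Coeff_injective ?_
  ext k
  rw [l2Coeff_synth, l2Coeff_apply, fourierCoeff_star, fourierCoeff_synth, unweight_starX]

/-- The weighted Fourier coefficients of `e^{inx}`. -/
def modeX (n : ℤ) : HSeq := lp.single 2 n (bracket n : ℂ)

theorem unweight_modeX (n k : ℤ) : unweight (modeX n) k = if k = n then 1 else 0 := by
  rw [unweight_apply, modeX, lp.single_apply, Pi.single_apply]
  split_ifs with h
  · subst h; push_cast; exact inv_mul_cancel₀ (bracket_ne_zero k)
  · simp

theorem synth_modeX (n : ℤ) : synth (modeX n) = fourier n := by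
  refine l2Coeff_injective ?_
  ext k
  rw [l2Coeff_synth, l2Coeff_apply, fourierCoeff_fourier, unweight_modeX, Pi.single_apply]

/-- The weighted Fourier coefficients of the potential `2 cos 2x`. -/
def potX : HSeq := modeX 2 + modeX (-2)

theorem fourier_circ_coe (n : ℤ) (x : ℝ) :
    fourier n (x : Circ) = Complex.exp (n * x * Complex.I) := by
  rw [fourier_coe_apply]
  congr 1
  have : (π : ℂ) ≠ 0 := by exact_mod_cast Real.pi_ne_zero
  push_cast
  field_simp

theorem synth_potX_apply (x : Circ) : synth potX x = (twoCosTwo x : ℂ) := by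
  induction x using QuotientAddGroup.induction_on with
  | H x =>
    rw [potX, map_add, synth_modeX, synth_modeX, ContinuousMap.add_apply, twoCosTwo_coe,
      fourier_circ_coe, fourier_circ_coe]
    push_cast
    rw [Complex.two_cos]
    congr 2
    ring

/-- The nonlinearity `2 cos(2x) |u|² u`, on weighted Fourier coefficients. -/
def cubic (x : HSeq) : HSeq := mulX potX (mulX (mulX x x) (starX x))

theorem synth_cubic (x : HSeq) : ⇑(synth (cubic x)) = nonlin (synth x) := by
  ext θ
  simp only [cubic, synth_mulX, ContinuousMap.mul_apply, synth_starX, ContinuousMap.star_apply,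
    nonlin, synth_potX_apply]
  have := Complex.mul_conj' (synth x θ)
  push_cast
  rw [← this, RCLike.star_def]
  ring

theorem continuous_cubic : Continuous cubic := by
  have h : Continuous fun x : HSeq => starX x := starX.continuous
  unfold cubic
  fun_prop

/-- A Lipschitz constant of the cubic nonlinearity, per square of the radius. -/
def cubConst : ℝ := (3 * embConst) ^ 3 * ‖potX‖

theorem cubConst_nonneg : 0 ≤ cubConst := by
  have := embConst_nonneg
  rw [cubConst]
  positivity

theorem norm_cubic_sub_le (x y : HSeq) :
    ‖cubic x - cubic y‖ ≤ cubConst * (‖x‖ + ‖y‖) ^ 2 * ‖x - y‖ := by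
  set B := 3 * embConst with hB
  have hB0 : 0 ≤ B := mul_nonneg (by norm_num) embConst_nonneg
  have e1 : mulX x x - mulX y y = mulX (x - y) x + mulX y (x - y) := by
    rw [mulX_sub_left, mulX_sub_right]; abel
  have e2 : mulX (mulX x x) (starX x) - mulX (mulX y y) (starX y)
      = mulX (mulX x x) (starX (x - y)) + mulX (mulX x x - mulX y y) (starX y) := by
    rw [map_sub, mulX_sub_left, mulX_sub_right]; abel
  have e3 : cubic x - cubic y
      = mulX potX (mulX (mulX x x) (starX x) - mulX (mulX y y) (starX y)) := by
    rw [mulX_sub_right]; rfl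
  set d := ‖x - y‖
  have hd : 0 ≤ d := norm_nonneg _
  have hx : 0 ≤ ‖x‖ := norm_nonneg _
  have hy : 0 ≤ ‖y‖ := norm_nonneg _
  have b1 : ‖mulX x x - mulX y y‖ ≤ B * (‖x‖ + ‖y‖) * d := by
    rw [e1]
    have h1 : ‖mulX (x - y) x‖ ≤ B * d * ‖x‖ := norm_mulX_le _ _
    have h2 : ‖mulX y (x - y)‖ ≤ B * ‖y‖ * d := norm_mulX_le _ _
    linarith [norm_add_le (mulX (x - y) x) (mulX y (x - y))]
  have b2 : ‖mulX (mulX x x) (starX x) - mulX (mulX y y) (starX y)‖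
      ≤ B * (B * ‖x‖ * ‖x‖) * d + B * (B * (‖x‖ + ‖y‖) * d) * ‖y‖ := by
    rw [e2]
    have h0 : ‖mulX x x‖ ≤ B * ‖x‖ * ‖x‖ := norm_mulX_le _ _
    have h1 : ‖mulX (mulX x x) (starX (x - y))‖ ≤ B * ‖mulX x x‖ * ‖starX (x - y)‖ :=
      norm_mulX_le _ _
    have h2 : ‖mulX (mulX x x - mulX y y) (starX y)‖ ≤ B * ‖mulX x x - mulX y y‖ * ‖starX y‖ :=
      norm_mulX_le _ _
    rw [LinearIsometry.norm_map] at h1 h2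
    refine (norm_add_le _ _).trans (add_le_add (h1.trans ?_) (h2.trans ?_)) <;> gcongr
  rw [e3]
  refine (norm_mulX_le _ _).trans ?_
  rw [← hB]
  have hp : 0 ≤ ‖potX‖ := norm_nonneg _
  calc B * ‖potX‖ * ‖mulX (mulX x x) (starX x) - mulX (mulX y y) (starX y)‖
      ≤ B * ‖potX‖ * (B * (B * ‖x‖ * ‖x‖) * d + B * (B * (‖x‖ + ‖y‖) * d) * ‖y‖) := by gcongr
    _ = B ^ 3 * ‖potX‖ * (‖x‖ ^ 2 + ‖x‖ * ‖y‖ + ‖y‖ ^ 2) * d := by ring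
    _ ≤ B ^ 3 * ‖potX‖ * (‖x‖ + ‖y‖) ^ 2 * d := by
        gcongr
        nlinarith [mul_nonneg hx hy]
    _ = cubConst * (‖x‖ + ‖y‖) ^ 2 * d := rfl

attribute [irreducible] l2Coeff synth wcoeff mulX starX modeX cubic

/-! ### The equation in the interaction picture -/

/-- The equation in the interaction picture: if `x(t)` are the weighted coefficients of a
solution, then `v(t) = freeFlow t (x(t))` solves `v' = nlsField σ t v`, whose right-hand side is
continuous. -/
def nlsField (σ t : ℝ) (v : HSeq) : HSeq :=
  (-(Complex.I * σ)) • freeFlow t (cubic (freeFlow (-t) v))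

/-- `v` is a curve of the interaction picture on the time interval `J`. -/
def IsCurve (J : Set ℝ) (σ : ℝ) (v : ℝ → HSeq) : Prop :=
  ∀ t ∈ J, HasDerivWithinAt v (nlsField σ t (v t)) J t

theorem IsCurve.continuousOn {J : Set ℝ} {σ : ℝ} {v : ℝ → HSeq} (h : IsCurve J σ v) :
    ContinuousOn v J := fun t ht => (h t ht).continuousWithinAt

theorem HSeq.hasDerivWithinAt_apply {v : ℝ → HSeq} {v' : HSeq} {J : Set ℝ} {t : ℝ}
    (h : HasDerivWithinAt v v' J t) (k : ℤ) : HasDerivWithinAt (fun r => v r k) (v' k) J t :=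
  (lp.evalCLM ℝ (fun _ : ℤ => ℂ) 2 k).hasFDerivAt.comp_hasDerivWithinAt t h

theorem continuousOn_freeFlow {J : Set ℝ} {f : ℝ → ℝ} {g : ℝ → HSeq} (hf : ContinuousOn f J)
    (hg : ContinuousOn g J) : ContinuousOn (fun t => freeFlow (f t) (g t)) J :=
  continuous_freeFlow.comp_continuousOn (hf.prodMk hg)

/-- A curve in `ℓ²(ℤ)` whose coordinates have the derivatives `F k`, with `F` continuous into
`ℓ²(ℤ)`, is differentiable in `ℓ²(ℤ)`. -/
theorem hasDerivWithinAt_of_coord {v F : ℝ → HSeq} {α β : ℝ} (hF : ContinuousOn F (Icc α β))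
    (h : ∀ k, ∀ s ∈ Icc α β, HasDerivWithinAt (fun s => v s k) (F s k) (Icc α β) s) :
    ∀ s ∈ Icc α β, HasDerivWithinAt v (F s) (Icc α β) s := by
  intro s hs
  have hα : α ∈ Icc α β := left_mem_Icc.2 (hs.1.trans hs.2)
  let w : ℝ → HSeq := fun t => v α + ∫ τ in α..t, F τ
  have hw : ∀ t ∈ Icc α β, HasDerivWithinAt w (F t) (Icc α β) t := fun t ht =>
    ODE.hasDerivWithinAt_picard_Icc (f := fun t _ => F t) (α := fun _ => 0) (u := univ) hα
      (hF.comp continuousOn_fst fun p hp => hp.1) continuousOn_const (fun _ _ => mem_univ _)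
      (v α) ht
  have hvw : ∀ t ∈ Icc α β, v t = w t := by
    intro t ht
    ext k
    have hd : ∀ r ∈ Icc α β, HasDerivWithinAt (fun r => v r k - w r k) 0 (Icc α β) r := by
      intro r hr
      have h1 := (h k r hr).sub (HSeq.hasDerivWithinAt_apply (hw r hr) k)
      rw [sub_self] at h1
      exact h1
    have := (convex_Icc α β).norm_image_sub_le_of_norm_hasDerivWithin_le (C := 0) hd
      (fun _ _ => by simp) hα ht
    have hwα : w α = v α := by simp [w]
    simpa [hwα, sub_eq_zero] using this
  exact (hw s hs).congr hvw (hvw s hs)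

theorem continuousOn_nlsField {J : Set ℝ} {v : ℝ → HSeq} (hv : ContinuousOn v J) (σ : ℝ) :
    ContinuousOn (fun t => nlsField σ t (v t)) J := by
  have h1 : ContinuousOn (fun t : ℝ => freeFlow (-t) (v t)) J :=
    continuousOn_freeFlow continuousOn_neg hv
  have h2 : ContinuousOn (fun t : ℝ => cubic (freeFlow (-t) (v t))) J :=
    continuous_cubic.comp_continuousOn h1
  have h3 : ContinuousOn (fun t : ℝ => freeFlow t (cubic (freeFlow (-t) (v t)))) J :=
    continuousOn_freeFlow continuousOn_id h2
  exact h3.const_smul (-(Complex.I * σ))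

theorem wcoeff_apply {u : C(Circ, ℂ)} (h : MemH1 u) (k : ℤ) :
    wcoeff u k = bracket k * fourierCoeff u k := by
  rw [wcoeff, dif_pos h]

theorem fourierCoeff_nonlin (x : HSeq) (k : ℤ) :
    fourierCoeff (nonlin (synth x)) k = unweight (cubic x) k := by
  rw [← synth_cubic, fourierCoeff_synth]

theorem hasDerivWithinAt_phase (c : ℝ) (J : Set ℝ) (t : ℝ) :
    HasDerivWithinAt (fun s : ℝ => Complex.exp ((c * s : ℝ) * Complex.I))
      (Complex.exp ((c * t : ℝ) * Complex.I) * (c * Complex.I)) J t := by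
  have h1 : HasDerivAt (fun s : ℝ => ((c * s : ℝ) : ℂ) * Complex.I) (c * Complex.I) t := by
    have := ((hasDerivAt_id t).const_mul c).ofReal_comp.mul_const Complex.I
    simpa using this
  exact h1.cexp.hasDerivWithinAt

theorem IsSolutionOn.mono {J J' : Set ℝ} {σ ε : ℝ} {ψ : ℝ → C(Circ, ℂ)}
    (h : IsSolutionOn J σ ε ψ) (hJ : J' ⊆ J) : IsSolutionOn J' σ ε ψ where
  memH1 t ht := h.memH1 t (hJ ht)
  continuous t ht := (h.continuous t (hJ ht)).mono_left (nhdsWithin_mono t hJ)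
  equation t ht k := by
    obtain ⟨d, hd, he⟩ := h.equation t (hJ ht) k
    exact ⟨d, hd.mono hJ, he⟩
  initial := h.initial

/-- A solution of class `C(J; H¹)` becomes continuously differentiable in the interaction
picture. -/
theorem IsSolutionOn.isCurve {α β σ ε : ℝ} {ψ : ℝ → C(Circ, ℂ)}
    (h : IsSolutionOn (Icc α β) σ ε ψ) :
    IsCurve (Icc α β) σ (fun t => freeFlow t (wcoeff (ψ t))) := by
  have hx : ContinuousOn (fun t => wcoeff (ψ t)) (Icc α β) := by
    intro t ht
    rw [ContinuousWithinAt, tendsto_iff_norm_sub_tendsto_zero]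
    refine (h.continuous t ht).congr' ?_
    filter_upwards [self_mem_nhdsWithin] with s hs
    rw [← h1Norm_synth, map_sub, synth_wcoeff (h.memH1 s hs), synth_wcoeff (h.memH1 t ht)]
  have hv : ContinuousOn (fun t => freeFlow t (wcoeff (ψ t))) (Icc α β) :=
    continuousOn_freeFlow continuousOn_id hx
  refine hasDerivWithinAt_of_coord (continuousOn_nlsField hv σ) fun k t ht => ?_
  obtain ⟨d, hd, he⟩ := h.equation t ht k
  have h1 := (hasDerivWithinAt_phase ((k : ℝ) ^ 2) (Icc α β) t).mul
    (hd.const_mul (bracket k : ℂ))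
  have h2 : HasDerivWithinAt (fun s => freeFlow s (wcoeff (ψ s)) k) _ (Icc α β) t :=
    h1.congr (fun s hs => by rw [freeFlow_apply, wcoeff_apply (h.memH1 s hs)]; rfl)
      (by rw [freeFlow_apply, wcoeff_apply (h.memH1 t ht)]; rfl)
  refine h2.congr_deriv ?_
  have hd' : d = -(Complex.I * (k ^ 2 * fourierCoeff (ψ t) k
      + σ * fourierCoeff (nonlin (ψ t)) k)) := by
    rw [← he, ← mul_assoc, Complex.I_mul_I]; ring
  have hn : fourierCoeff (nonlin (ψ t)) k = unweight (cubic (wcoeff (ψ t))) k := by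
    rw [← fourierCoeff_nonlin, synth_wcoeff (h.memH1 t ht)]
  rw [hd', hn, nlsField, freeFlow_freeFlow, neg_add_cancel, freeFlow_zero, lp.coeFn_smul,
    Pi.smul_apply, freeFlow_apply, unweight_apply, smul_eq_mul]
  have := bracket_ne_zero k
  push_cast
  field_simp
  ring

/-- The weighted coefficients of the initial datum `ε (cos x + sin x)`. -/
def initX (ε : ℝ) : HSeq :=
  ((ε / 2 : ℝ) * (1 - Complex.I)) • modeX 1 + ((ε / 2 : ℝ) * (1 + Complex.I)) • modeX (-1)

theorem synth_initX (ε x : ℝ) :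
    synth (initX ε) (x : Circ) = ((ε * (Real.cos x + Real.sin x) : ℝ) : ℂ) := by
  rw [initX, map_add, map_smul, map_smul, synth_modeX, synth_modeX, ContinuousMap.add_apply,
    ContinuousMap.smul_apply, ContinuousMap.smul_apply, fourier_circ_coe, fourier_circ_coe]
  push_cast
  rw [Complex.cos, Complex.sin]
  simp only [one_mul, neg_mul, smul_eq_mul]
  ring

theorem IsSolutionOn.wcoeff_zero {J : Set ℝ} {σ ε : ℝ} {ψ : ℝ → C(Circ, ℂ)}
    (h : IsSolutionOn J σ ε ψ) : wcoeff (ψ 0) = initX ε := by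
  have : ψ 0 = synth (initX ε) := by
    ext x
    induction x using QuotientAddGroup.induction_on with
    | H x => exact (h.initial x).trans (synth_initX ε x).symm
  rw [this, wcoeff_synth]

theorem IsCurve.isSolutionOn {J : Set ℝ} {σ ε : ℝ} {v : ℝ → HSeq} (h : IsCurve J σ v)
    (h0 : v 0 = initX ε) : IsSolutionOn J σ ε (fun t => synth (freeFlow (-t) (v t))) where
  memH1 t _ := memH1_synth _
  continuous t ht := by
    have h1 : ContinuousOn (fun t : ℝ => freeFlow (-t) (v t)) J :=
      continuousOn_freeFlow continuousOn_neg h.continuousOn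
    simp_rw [← map_sub, h1Norm_synth]
    exact tendsto_iff_norm_sub_tendsto_zero.1 (h1 t ht)
  equation t ht k := by
    have h1 := HSeq.hasDerivWithinAt_apply (h t ht) k
    have h2 := (hasDerivWithinAt_phase (-(k : ℝ) ^ 2) J t).mul
      (h1.const_mul (((bracket k)⁻¹ : ℝ) : ℂ))
    have h3 : HasDerivWithinAt (fun s => fourierCoeff (synth (freeFlow (-s) (v s))) k) _ J t :=
      h2.congr (fun s hs => by
          rw [fourierCoeff_synth, unweight_apply, freeFlow_apply, ← mul_assoc,
            mul_comm (((bracket k)⁻¹ : ℝ) : ℂ), mul_assoc, mul_neg, ← neg_mul]; rfl)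
        (by rw [fourierCoeff_synth, unweight_apply, freeFlow_apply, ← mul_assoc,
            mul_comm (((bracket k)⁻¹ : ℝ) : ℂ), mul_assoc, mul_neg, ← neg_mul]; rfl)
    refine ⟨_, h3, ?_⟩
    rw [fourierCoeff_nonlin, fourierCoeff_synth, nlsField, lp.coeFn_smul, Pi.smul_apply,
      freeFlow_apply, smul_eq_mul, unweight_apply, unweight_apply, freeFlow_apply]
    have hE : Complex.exp ((-(k : ℝ) ^ 2 * t : ℝ) * Complex.I)
        * Complex.exp (((k : ℝ) ^ 2 * t : ℝ) * Complex.I) = 1 := by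
      rw [← Complex.exp_add, ← Complex.exp_zero]; congr 1; push_cast; ring
    have hE' : Complex.exp (((k : ℝ) ^ 2 * -t : ℝ) * Complex.I)
        = Complex.exp ((-(k : ℝ) ^ 2 * t : ℝ) * Complex.I) := by
      congr 3; ring
    rw [hE']
    generalize Complex.exp ((-(k : ℝ) ^ 2 * t : ℝ) * Complex.I) = E at *
    generalize Complex.exp (((k : ℝ) ^ 2 * t : ℝ) * Complex.I) = E' at *
    generalize cubic (freeFlow (-t) (v t)) k = g at *
    push_cast
    have hI := Complex.I_sq
    linear_combination (-(k : ℂ) ^ 2 * E * (bracket k : ℂ)⁻¹ * v t k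
      - σ * (bracket k : ℂ)⁻¹ * g * E * E') * hI + σ * (bracket k : ℂ)⁻¹ * g * hE
  initial x := by
    simp only [neg_zero, freeFlow_zero, h0]
    exact synth_initX ε x

/-! ### Conservation of mass and energy -/

theorem inner_freeFlow (t : ℝ) (x y : HSeq) :
    inner ℂ (freeFlow t x) (freeFlow t y) = inner ℂ x y :=
  (⟨(freeFlow t).toLinearMap, norm_freeFlow t⟩ : HSeq →ₗᵢ[ℂ] HSeq).inner_map_map x y

theorem inner_unweight_left (x y : HSeq) :
    inner ℂ (unweight x) y = inner ℂ x (unweight y) := by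
  rw [lp.inner_eq_tsum, lp.inner_eq_tsum]
  refine tsum_congr fun k => ?_
  simp only [unweight_apply, RCLike.inner_apply, map_mul, Complex.conj_ofReal]
  ring

theorem unweight_freeFlow (t : ℝ) (x : HSeq) :
    unweight (freeFlow t x) = freeFlow t (unweight x) := by
  ext k
  simp only [unweight_apply, freeFlow_apply]
  ring

/-- The potential energy `½ ∫ 2 cos(2x) |u|⁴` (normalized integral). -/
def potEnergy (x : HSeq) : ℝ := ∫ θ, twoCosTwo θ * ‖synth x θ‖ ^ 4 / 2 ∂haarAddCircle

theorem continuous_twoCosTwo : Continuous twoCosTwo := by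
  have h : Continuous fun θ => (synth potX θ).re :=
    Complex.continuous_re.comp (synth potX).continuous
  simpa only [synth_potX_apply, Complex.ofReal_re] using h

/-- The `L²` pairing of `u` with `2 cos(2x) |u|² u` is real. This is gauge invariance. -/
theorem inner_unweight_cubic_im (x : HSeq) :
    (inner ℂ (unweight x) (unweight (cubic x))).im = 0 := by
  have h : inner ℂ (unweight x) (unweight (cubic x))
      = ((∫ θ, twoCosTwo θ * ‖synth x θ‖ ^ 4 ∂haarAddCircle : ℝ) : ℂ) := by
    rw [← l2Coeff_synth, ← l2Coeff_synth, inner_l2Coeff, ← integral_complex_ofReal]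
    refine integral_congr_ae (Eventually.of_forall fun θ => ?_)
    simp only [synth_cubic, nonlin]
    rw [mul_assoc, Complex.mul_conj']
    push_cast
    ring
  rw [h, Complex.ofReal_im]

theorem hasDerivWithinAt_norm_sq {w : ℝ → HSeq} {w' : HSeq} {J : Set ℝ} {t : ℝ}
    (h : HasDerivWithinAt w w' J t) :
    HasDerivWithinAt (fun s => ‖w s‖ ^ 2) (2 * (inner ℂ (w t) w').re) J t := by
  have h1 := Complex.reCLM.hasFDerivAt.comp_hasDerivWithinAt t (h.inner ℂ h)
  refine (h1.congr_deriv ?_).congr (fun s _ => ?_) ?_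
  · have h2 : (inner ℂ w' (w t)).re = (inner ℂ (w t) w').re := inner_re_symm (𝕜 := ℂ) w' (w t)
    rw [Complex.reCLM_apply, Complex.add_re, h2]
    ring
  · exact (inner_self_eq_norm_sq (𝕜 := ℂ) (w s)).symm
  · exact (inner_self_eq_norm_sq (𝕜 := ℂ) (w t)).symm

theorem eq_of_hasDerivWithinAt_zero {f : ℝ → ℝ} {α β s t : ℝ}
    (h : ∀ r ∈ Icc α β, HasDerivWithinAt f 0 (Icc α β) r) (hs : s ∈ Icc α β)
    (ht : t ∈ Icc α β) : f t = f s := by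
  have := (convex_Icc α β).norm_image_sub_le_of_norm_hasDerivWithin_le (C := 0) h
    (fun _ _ => by simp) hs ht
  simpa [sub_eq_zero] using this

theorem IsCurve.mass_eq {α β σ s t : ℝ} {v : ℝ → HSeq} (h : IsCurve (Icc α β) σ v)
    (hs : s ∈ Icc α β) (ht : t ∈ Icc α β) : ‖unweight (v t)‖ ^ 2 = ‖unweight (v s)‖ ^ 2 := by
  refine eq_of_hasDerivWithinAt_zero (f := fun r => ‖unweight (v r)‖ ^ 2) (fun r hr => ?_) hs ht
  have h1 : HasDerivWithinAt (fun r => unweight (v r)) (unweight (nlsField σ r (v r)))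
      (Icc α β) r :=
    ((unweight.restrictScalars ℝ).hasFDerivAt.comp_hasDerivWithinAt r (h r hr))
  refine (hasDerivWithinAt_norm_sq h1).congr_deriv ?_
  obtain ⟨x, hx⟩ : ∃ x, x = freeFlow (-r) (v r) := ⟨_, rfl⟩
  have hv : v r = freeFlow r x := by rw [hx, freeFlow_freeFlow, add_neg_cancel, freeFlow_zero]
  have him := inner_unweight_cubic_im x
  rw [nlsField, ← hx, hv, map_smul, unweight_freeFlow, unweight_freeFlow, inner_smul_right,
    inner_freeFlow]
  simp [him]

/-- The function `½ V (|u|² + |w|²)(u + w)` with `V = 2 cos 2x`, whose pairing with `u - w` is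
the difference of the potential energies of `u` and `w`. -/
def potSecant (x y : HSeq) : HSeq :=
  (2⁻¹ : ℂ) • mulX potX (mulX (mulX x (starX x) + mulX y (starX y)) (x + y))

theorem synth_potSecant (x y : HSeq) (θ : Circ) : synth (potSecant x y) θ
    = 2⁻¹ * ((twoCosTwo θ : ℂ) * (((‖synth x θ‖ ^ 2 + ‖synth y θ‖ ^ 2 : ℝ) : ℂ)
      * (synth x θ + synth y θ))) := by
  simp only [potSecant, map_smul, synth_mulX, ContinuousMap.smul_apply, ContinuousMap.mul_apply,
    synth_potX_apply, synth_starX, ContinuousMap.star_apply, map_add, ContinuousMap.add_apply,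
    RCLike.star_def, smul_eq_mul, Complex.mul_conj']
  push_cast
  ring

theorem potSecant_self (x : HSeq) : potSecant x x = (2 : ℂ) • cubic x := by
  refine synth_injective (ContinuousMap.ext fun θ => ?_)
  rw [synth_potSecant, map_smul, ContinuousMap.smul_apply, synth_cubic, nonlin, smul_eq_mul]
  push_cast
  ring

theorem potEnergy_sub (x y : HSeq) : potEnergy x - potEnergy y
    = (inner ℂ (unweight (potSecant x y)) (unweight (x - y))).re := by
  have hi (x : HSeq) : Integrable (fun θ => twoCosTwo θ * ‖synth x θ‖ ^ 4 / 2)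
      (haarAddCircle (T := 2 * π)) := by
    have hc : Continuous fun θ => twoCosTwo θ * ‖synth x θ‖ ^ 4 / 2 :=
      (continuous_twoCosTwo.mul (((synth x).continuous.norm).pow 4)).div_const 2
    exact hc.integrable_of_hasCompactSupport (HasCompactSupport.of_compactSpace _)
  rw [potEnergy, potEnergy, ← integral_sub (hi x) (hi y), ← l2Coeff_synth, ← l2Coeff_synth,
    inner_l2Coeff, ← RCLike.re_eq_complex_re, ← integral_re]
  · refine integral_congr_ae (Eventually.of_forall fun θ => ?_)
    simp only [synth_potSecant, map_sub, ContinuousMap.sub_apply, RCLike.re_eq_complex_re]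
    generalize synth x θ = a
    generalize synth y θ = b
    simp only [map_mul, map_add, Complex.conj_ofReal, map_inv₀, map_ofNat]
    have h1 : ‖a‖ ^ 2 = a.re ^ 2 + a.im ^ 2 := by
      rw [← Complex.normSq_eq_norm_sq, Complex.normSq_apply]; ring
    have h2 : ‖b‖ ^ 2 = b.re ^ 2 + b.im ^ 2 := by
      rw [← Complex.normSq_eq_norm_sq, Complex.normSq_apply]; ring
    have h3 : (a - b) * (2⁻¹ * ((twoCosTwo θ : ℂ) * (((‖a‖ ^ 2 + ‖b‖ ^ 2 : ℝ) : ℂ)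
        * ((starRingEnd ℂ) a + (starRingEnd ℂ) b))))
        = ((2⁻¹ * (twoCosTwo θ * (‖a‖ ^ 2 + ‖b‖ ^ 2)) : ℝ) : ℂ)
          * ((a - b) * ((starRingEnd ℂ) a + (starRingEnd ℂ) b)) := by
      push_cast; ring
    rw [h3, Complex.re_ofReal_mul]
    simp only [Complex.mul_re, Complex.sub_re, Complex.sub_im, Complex.add_re, Complex.add_im,
      Complex.conj_re, Complex.conj_im]
    have h4 : ‖a‖ ^ 4 = (‖a‖ ^ 2) ^ 2 := by ring
    have h5 : ‖b‖ ^ 4 = (‖b‖ ^ 2) ^ 2 := by ring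
    rw [h4, h5, h1, h2]
    ring
  · have hc : Continuous fun θ => synth (x - y) θ * (starRingEnd ℂ) (synth (potSecant x y) θ) :=
      (synth (x - y)).continuous.mul
        (Complex.continuous_conj.comp (synth (potSecant x y)).continuous)
    exact hc.integrable_of_hasCompactSupport (HasCompactSupport.of_compactSpace _)

/-- The symbol `(e^{-ik²h} - 1) / (h ⟨k⟩²)` of the difference quotient of the free evolution,
smoothed by two derivatives. -/
def quotSymbol (h : ℝ) (k : ℤ) : ℂ :=
  ((h * (1 + (k : ℝ) ^ 2) : ℝ) : ℂ)⁻¹ * (Complex.exp (((k : ℝ) ^ 2 * -h : ℝ) * Complex.I) - 1)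

/-- For `h = 0` the symbol has the junk value `0`, so no hypothesis on `h` is needed. -/
theorem norm_quotSymbol_le (h : ℝ) (k : ℤ) : ‖quotSymbol h k‖ ≤ 1 := by
  have h1 : ‖Complex.exp (((k : ℝ) ^ 2 * -h : ℝ) * Complex.I) - 1‖ ≤ ‖(k : ℝ) ^ 2 * -h‖ := by
    rw [mul_comm]; exact Real.norm_exp_I_mul_ofReal_sub_one_le
  rw [quotSymbol, norm_mul, norm_inv, Complex.norm_real]
  refine inv_mul_le_one_of_le₀ (h1.trans ?_) (norm_nonneg _)
  rw [mul_comm, norm_mul, norm_mul, norm_neg]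
  gcongr
  rw [Real.norm_of_nonneg (by positivity), Real.norm_of_nonneg (by positivity)]
  linarith

theorem tendsto_quotSymbol (k : ℤ) :
    Tendsto (fun h => quotSymbol h k) (𝓝[≠] 0)
      (𝓝 (-Complex.I * (1 - ((bracket k)⁻¹ : ℝ) ^ 2))) := by
  have h1 := (hasDerivWithinAt_phase (-(k : ℝ) ^ 2) univ 0).hasDerivAt univ_mem
  have h2 := (hasDerivAt_iff_tendsto_slope.1 h1).const_mul (((1 + (k : ℝ) ^ 2 : ℝ) : ℂ)⁻¹)
  have hk : (1 + (k : ℂ) ^ 2) ≠ 0 := by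
    have : (1 + (k : ℝ) ^ 2) ≠ 0 := by positivity
    exact_mod_cast this
  have e : (((1 + (k : ℝ) ^ 2 : ℝ) : ℂ)⁻¹) * (Complex.exp ((-(k : ℝ) ^ 2 * 0 : ℝ) * Complex.I)
      * ((-(k : ℝ) ^ 2 : ℝ) * Complex.I)) = -Complex.I * (1 - ((bracket k)⁻¹ : ℝ) ^ 2) := by
    rw [mul_zero, Complex.ofReal_zero, zero_mul, Complex.exp_zero, ← Complex.ofReal_pow, inv_pow,
      bracket_sq]
    push_cast
    field_simp
    ring
  rw [e] at h2
  refine h2.congr fun h => ?_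
  rw [slope_def_module, quotSymbol, mul_zero, Complex.ofReal_zero, zero_mul, Complex.exp_zero,
    sub_zero, Complex.real_smul, neg_mul, mul_neg]
  push_cast
  rw [mul_inv]
  ring

theorem norm_quotLimit_le (k : ℤ) : ‖-Complex.I * (1 - (((bracket k)⁻¹ : ℝ) : ℂ) ^ 2)‖ ≤ 1 :=
  le_of_tendsto (tendsto_quotSymbol k).norm (Eventually.of_forall fun h => norm_quotSymbol_le h k)

theorem mult_quotSymbol (h : ℝ) (x : HSeq) :
    mult (quotSymbol h) (norm_quotSymbol_le h) x
      = h⁻¹ • unweight (unweight (freeFlow (-h) x - x)) := by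
  ext k
  rw [mult_apply, quotSymbol, lp.coeFn_smul, Pi.smul_apply, unweight_apply, unweight_apply,
    lp.coeFn_sub, Pi.sub_apply, freeFlow_apply, Complex.real_smul, ← bracket_sq]
  push_cast
  rw [mul_inv]
  ring

theorem mult_quotLimit (x : HSeq) :
    mult _ norm_quotLimit_le x = (-Complex.I) • (x - unweight (unweight x)) := by
  ext k
  rw [mult_apply, lp.coeFn_smul, Pi.smul_apply, lp.coeFn_sub, Pi.sub_apply, unweight_apply,
    unweight_apply, smul_eq_mul]
  ring

theorem continuous_potSecant (y : HSeq) : Continuous fun x => potSecant x y := by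
  have h : Continuous fun x : HSeq => starX x := starX.continuous
  unfold potSecant
  fun_prop

/-- The difference quotient of the potential energy. The increment of the solution splits into that
of the interaction picture, which is differentiable, and that of the free evolution, whose
difference quotient is only bounded after the loss of two derivatives. These are shared between the
solution and the other factor of the pairing, both of which lie in `H¹`. -/
theorem slope_potEnergy (v : ℝ → HSeq) (s t : ℝ) :
    slope (fun r => potEnergy (freeFlow (-r) (v r))) s t
      = (inner ℂ (potSecant (freeFlow (-t) (v t)) (freeFlow (-s) (v s)))
        (unweight (unweight (freeFlow (-t) (slope v s t)))
          + mult (quotSymbol (t - s)) (norm_quotSymbol_le _) (freeFlow (-s) (v s)))).re := by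
  have e : freeFlow (-t) (v t) - freeFlow (-s) (v s) = freeFlow (-t) (v t - v s)
      + (freeFlow (-(t - s)) (freeFlow (-s) (v s)) - freeFlow (-s) (v s)) := by
    rw [freeFlow_freeFlow, map_sub]
    ring_nf
    abel
  have hr (a : ℝ) (y : HSeq) : a • y = (a : ℂ) • y := rfl
  rw [slope_def_module, potEnergy_sub, inner_unweight_left, e, mult_quotSymbol, slope_def_module,
    hr, hr, map_smul, map_add, map_add, map_smul, map_smul, ← smul_add, inner_smul_right,
    Complex.re_ofReal_mul, smul_eq_mul]

/-- The potential energy is differentiable along curves of the interaction picture, although the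
solution itself is differentiable only with values in `H⁻¹`. -/
theorem IsCurve.hasDerivWithinAt_potEnergy {J : Set ℝ} {σ s : ℝ} {v : ℝ → HSeq}
    (h : IsCurve J σ v) (hs : s ∈ J) :
    HasDerivWithinAt (fun r => potEnergy (freeFlow (-r) (v r)))
      (2 * (inner ℂ (cubic (freeFlow (-s) (v s))) (freeFlow (-s) (v s))).im) J s := by
  obtain ⟨x, hx⟩ : ∃ x, x = freeFlow (-s) (v s) := ⟨_, rfl⟩
  rw [hasDerivWithinAt_iff_tendsto_slope]
  have hx1 : ContinuousWithinAt (fun r => freeFlow (-r) (v r)) J s :=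
    continuousOn_freeFlow continuousOn_neg h.continuousOn s hs
  have hY : Tendsto (fun t => potSecant (freeFlow (-t) (v t)) x) (𝓝[J \ {s}] s)
      (𝓝 ((2 : ℂ) • cubic x)) := by
    rw [← potSecant_self]
    have h0 : Tendsto (fun r => freeFlow (-r) (v r)) (𝓝[J \ {s}] s) (𝓝 x) := by
      rw [hx]
      exact hx1.tendsto.mono_left (nhdsWithin_mono s sdiff_subset)
    exact ((continuous_potSecant x).tendsto x).comp h0
  have hV : Tendsto (fun t => freeFlow (-t) (slope v s t)) (𝓝[J \ {s}] s)
      (𝓝 (freeFlow (-s) (nlsField σ s (v s)))) := by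
    have h1 : Tendsto (fun t : ℝ => -t) (𝓝[J \ {s}] s) (𝓝 (-s)) :=
      (continuous_neg.tendsto s).mono_left nhdsWithin_le_nhds
    exact (continuous_freeFlow.tendsto (-s, nlsField σ s (v s))).comp
      (h1.prodMk_nhds (hasDerivWithinAt_iff_tendsto_slope.1 (h s hs)))
  have hW : Tendsto (fun t => mult (quotSymbol (t - s)) (norm_quotSymbol_le _) x) (𝓝[J \ {s}] s)
      (𝓝 ((-Complex.I) • (x - unweight (unweight x)))) := by
    rw [← mult_quotLimit]
    refine tendsto_mult _ _ (fun k => (tendsto_quotSymbol k).comp ?_) x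
    refine tendsto_nhdsWithin_iff.2 ⟨?_, ?_⟩
    · have : Tendsto (fun t : ℝ => t - s) (𝓝 s) (𝓝 (s - s)) := Continuous.tendsto (by fun_prop) s
      rw [sub_self] at this
      exact this.mono_left nhdsWithin_le_nhds
    · filter_upwards [self_mem_nhdsWithin] with t ht
      exact sub_ne_zero.2 ht.2
  have hU : Tendsto (fun t => unweight (unweight (freeFlow (-t) (slope v s t)))) (𝓝[J \ {s}] s)
      (𝓝 (unweight (unweight (freeFlow (-s) (nlsField σ s (v s)))))) :=
    ((unweight.continuous.comp unweight.continuous).tendsto _).comp hV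
  have hlim := (Complex.continuous_re.tendsto _).comp (hY.inner (𝕜 := ℂ) (hU.add hW))
  have hval : (inner ℂ ((2 : ℂ) • cubic x) (unweight (unweight (freeFlow (-s)
      (nlsField σ s (v s)))) + (-Complex.I) • (x - unweight (unweight x)))).re
      = 2 * (inner ℂ (cubic x) x).im := by
    have him2 := inner_unweight_cubic_im x
    have him3 : (inner ℂ (cubic x) (unweight (unweight x))).im = 0 := by
      rw [← inner_unweight_left, ← inner_conj_symm, Complex.conj_im, him2, neg_zero]
    have hself : (inner ℂ (cubic x) (unweight (unweight (cubic x)))).im = 0 := by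
      rw [← inner_unweight_left]
      exact inner_self_im (𝕜 := ℂ) (unweight (cubic x))
    rw [nlsField, ← hx, map_smul, freeFlow_freeFlow, neg_add_cancel, freeFlow_zero, map_smul,
      map_smul, inner_add_right, inner_smul_left, inner_smul_right, inner_smul_left,
      inner_smul_right, inner_sub_right]
    simp [hself, him3]
  rw [hval] at hlim
  rw [← hx]
  refine hlim.congr fun t => ?_
  rw [slope_potEnergy, ← hx]
  rfl

/-- Conservation of energy, where `‖v‖²` is the sum of the mass and of the kinetic energy. -/
theorem IsCurve.energy_eq {α β σ s t : ℝ} {v : ℝ → HSeq} (h : IsCurve (Icc α β) σ v)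
    (hs : s ∈ Icc α β) (ht : t ∈ Icc α β) :
    ‖v t‖ ^ 2 + σ * potEnergy (freeFlow (-t) (v t))
      = ‖v s‖ ^ 2 + σ * potEnergy (freeFlow (-s) (v s)) := by
  refine eq_of_hasDerivWithinAt_zero
    (f := fun r => ‖v r‖ ^ 2 + σ * potEnergy (freeFlow (-r) (v r))) (fun r hr => ?_) hs ht
  refine ((hasDerivWithinAt_norm_sq (h r hr)).add
    ((h.hasDerivWithinAt_potEnergy hr).const_mul σ)).congr_deriv ?_
  obtain ⟨x, hx⟩ : ∃ x, x = freeFlow (-r) (v r) := ⟨_, rfl⟩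
  have hv : v r = freeFlow r x := by rw [hx, freeFlow_freeFlow, add_neg_cancel, freeFlow_zero]
  have him : (inner ℂ x (cubic x)).im = -(inner ℂ (cubic x) x).im := by
    rw [← inner_conj_symm, Complex.conj_im]
  rw [nlsField, ← hx, hv, inner_smul_right, inner_freeFlow]
  simp only [Complex.mul_re, Complex.neg_re, Complex.neg_im, Complex.mul_im, Complex.I_re,
    Complex.I_im, Complex.ofReal_re, Complex.ofReal_im, him]
  ring

/-! ### Symmetry, uniqueness and the a priori bound -/

theorem norm_nlsField_sub_le (σ t : ℝ) (v w : HSeq) :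
    ‖nlsField σ t v - nlsField σ t w‖ ≤ |σ| * (cubConst * (‖v‖ + ‖w‖) ^ 2) * ‖v - w‖ := by
  have h1 : ‖cubic (freeFlow (-t) v) - cubic (freeFlow (-t) w)‖
      ≤ cubConst * (‖v‖ + ‖w‖) ^ 2 * ‖v - w‖ := by
    have := norm_cubic_sub_le (freeFlow (-t) v) (freeFlow (-t) w)
    rwa [← map_sub, norm_freeFlow, norm_freeFlow, norm_freeFlow] at this
  rw [nlsField, nlsField, ← smul_sub, ← map_sub, norm_smul, norm_freeFlow, norm_neg, norm_mul,
    Complex.norm_I, one_mul, Complex.norm_real, Real.norm_eq_abs, mul_assoc]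
  gcongr

/-- Uniqueness for the equation in the interaction picture. -/
theorem IsCurve.eqOn {α β σ : ℝ} {v w : ℝ → HSeq} (hv : IsCurve (Icc α β) σ v)
    (hw : IsCurve (Icc α β) σ w) (h0 : (0 : ℝ) ∈ Icc α β) (h : v 0 = w 0) :
    EqOn v w (Icc α β) := by
  obtain ⟨R₁, hR₁⟩ := isCompact_Icc.exists_bound_of_continuousOn hv.continuousOn
  obtain ⟨R₂, hR₂⟩ := isCompact_Icc.exists_bound_of_continuousOn hw.continuousOn
  set R := max R₁ R₂
  let K : NNReal := (|σ| * (cubConst * (R + R) ^ 2)).toNNReal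
  have hL : ∀ t, LipschitzOnWith K (nlsField σ t) {x | ‖x‖ ≤ R} := by
    intro t
    refine LipschitzOnWith.of_dist_le_mul fun x hx y hy => ?_
    rw [dist_eq_norm, dist_eq_norm, Real.coe_toNNReal _
      (mul_nonneg (abs_nonneg _) (mul_nonneg cubConst_nonneg (sq_nonneg _)))]
    refine (norm_nlsField_sub_le σ t x y).trans ?_
    have := cubConst_nonneg
    have hx' : ‖x‖ ≤ R := hx
    have hy' : ‖y‖ ≤ R := hy
    gcongr
  have hvR : ∀ t ∈ Icc α β, v t ∈ {x : HSeq | ‖x‖ ≤ R} := fun t ht =>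
    (hR₁ t ht).trans (le_max_left _ _)
  have hwR : ∀ t ∈ Icc α β, w t ∈ {x : HSeq | ‖x‖ ≤ R} := fun t ht =>
    (hR₂ t ht).trans (le_max_right _ _)
  have hsub1 : Icc 0 β ⊆ Icc α β := Icc_subset_Icc_left h0.1
  have hsub2 : Icc α 0 ⊆ Icc α β := Icc_subset_Icc_right h0.2
  have hright : ∀ {u : ℝ → HSeq}, IsCurve (Icc α β) σ u → ∀ t ∈ Ico 0 β,
      HasDerivWithinAt u (nlsField σ t (u t)) (Ici t) t := fun hu t ht =>
    (hu t (hsub1 (Ico_subset_Icc_self ht))).mono_of_mem_nhdsWithin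
      (mem_of_superset (Icc_mem_nhdsGE ht.2) (Icc_subset_Icc_left (h0.1.trans ht.1)))
  have hleft : ∀ {u : ℝ → HSeq}, IsCurve (Icc α β) σ u → ∀ t ∈ Ioc α 0,
      HasDerivWithinAt u (nlsField σ t (u t)) (Iic t) t := fun hu t ht =>
    (hu t (hsub2 (Ioc_subset_Icc_self ht))).mono_of_mem_nhdsWithin
      (mem_of_superset (Icc_mem_nhdsLE ht.1) (Icc_subset_Icc_right (ht.2.trans h0.2)))
  intro t ht
  rcases le_total 0 t with h' | h'
  · exact ODE_solution_unique_of_mem_Icc_right (s := fun _ => {x : HSeq | ‖x‖ ≤ R})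
      (fun t _ => hL t)
      (hv.continuousOn.mono hsub1) (hright hv)
      (fun t ht => hvR t (hsub1 (Ico_subset_Icc_self ht)))
      (hw.continuousOn.mono hsub1) (hright hw)
      (fun t ht => hwR t (hsub1 (Ico_subset_Icc_self ht))) h ⟨h', ht.2⟩
  · exact ODE_solution_unique_of_mem_Icc_left (s := fun _ => {x : HSeq | ‖x‖ ≤ R})
      (fun t _ => hL t)
      (hv.continuousOn.mono hsub2) (hleft hv)
      (fun t ht => hvR t (hsub2 (Ioc_subset_Icc_self ht)))
      (hw.continuousOn.mono hsub2) (hleft hw)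
      (fun t ht => hwR t (hsub2 (Ioc_subset_Icc_self ht))) h ⟨ht.1, h'⟩

theorem unweight_halfShift (x : HSeq) (k : ℤ) :
    unweight (halfShift x) k = ((((-1 : ℤˣ) ^ k : ℤˣ) : ℤ) : ℂ) * unweight x k := by
  rw [unweight_apply, unweight_apply, halfShift_apply]; ring

theorem mulX_halfShift (x y : HSeq) :
    mulX (halfShift x) (halfShift y) = halfShift (mulX x y) := by
  refine unweight_injective ?_
  ext k
  rw [unweight_halfShift]
  refine (hasSum_unweight_mulX _ _ k).unique ?_
  convert! (hasSum_unweight_mulX x y k).mul_left ((((-1 : ℤˣ) ^ k : ℤˣ) : ℤ) : ℂ) using 1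
  ext j
  have h : (-1 : ℤˣ) ^ k = (-1) ^ j * (-1) ^ (k - j) := by rw [← zpow_add]; congr 1; ring
  rw [unweight_halfShift, unweight_halfShift, h]
  push_cast
  ring

theorem starX_halfShift (x : HSeq) : starX (halfShift x) = halfShift (starX x) := by
  ext k
  rw [starX_apply, halfShift_apply, halfShift_apply, starX_apply, map_mul, zpow_neg]
  rcases Int.units_eq_one_or ((-1 : ℤˣ) ^ k) with h | h <;> simp [h]

theorem halfShift_modeX (n : ℤ) :
    halfShift (modeX n) = ((((-1 : ℤˣ) ^ n : ℤˣ) : ℤ) : ℂ) • modeX n := by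
  refine unweight_injective ?_
  ext k
  rw [unweight_halfShift, map_smul, lp.coeFn_smul, Pi.smul_apply, unweight_modeX, smul_eq_mul]
  split_ifs with h
  · rw [h]
  · rw [mul_zero, mul_zero]

theorem halfShift_potX : halfShift potX = potX := by
  have h : (-1 : ℤˣ) ^ (2 : ℤ) = 1 := by decide
  have h' : (-1 : ℤˣ) ^ (-2 : ℤ) = 1 := by decide
  simp [potX, halfShift_modeX, h, h']

theorem cubic_halfShift (x : HSeq) : cubic (halfShift x) = halfShift (cubic x) := by
  rw [cubic, cubic, starX_halfShift, mulX_halfShift, mulX_halfShift, ← mulX_halfShift potX,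
    halfShift_potX]

theorem cubic_neg (x : HSeq) : cubic (-x) = -cubic x := by
  refine synth_injective (ContinuousMap.ext fun θ => ?_)
  rw [map_neg, ContinuousMap.neg_apply, synth_cubic, synth_cubic, nonlin, nonlin, map_neg,
    ContinuousMap.neg_apply, norm_neg, mul_neg]

theorem freeFlow_halfShift (t : ℝ) (x : HSeq) :
    freeFlow t (halfShift x) = halfShift (freeFlow t x) := by
  ext k
  simp only [freeFlow_apply, halfShift_apply]
  ring

theorem nlsField_neg_halfShift (σ t : ℝ) (v : HSeq) :
    nlsField σ t (-halfShift v) = -halfShift (nlsField σ t v) := by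
  rw [nlsField, nlsField, map_neg, freeFlow_halfShift, cubic_neg, cubic_halfShift, map_neg,
    freeFlow_halfShift, map_smul, smul_neg]

theorem halfShift_initX (ε : ℝ) : -halfShift (initX ε) = initX ε := by
  have h' : (-1 : ℤˣ) ^ (-1 : ℤ) = -1 := by decide
  simp [initX, halfShift_modeX, h', add_comm]

/-- The equation commutes with `u ↦ -u(· + π)` and the initial datum is invariant under it.
Hence the even Fourier modes vanish for all times. -/
theorem IsCurve.even_modes_eq_zero {α β σ ε : ℝ} {v : ℝ → HSeq} (hv : IsCurve (Icc α β) σ v)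
    (h0 : (0 : ℝ) ∈ Icc α β) (hi : v 0 = initX ε) {t : ℝ} (ht : t ∈ Icc α β) {k : ℤ}
    (hk : Even k) : v t k = 0 := by
  have hw : IsCurve (Icc α β) σ (fun t => -halfShift (v t)) := by
    intro t ht
    simp only [nlsField_neg_halfShift]
    have h1 : HasDerivWithinAt (fun r => halfShift (v r)) (halfShift (nlsField σ t (v t)))
        (Icc α β) t :=
      (halfShift.restrictScalars ℝ).hasFDerivAt.comp_hasDerivWithinAt t (hv t ht)
    exact h1.neg
  have h1 := hv.eqOn hw h0 (by simp only [hi, halfShift_initX]) ht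
  have h2 : v t k = -(halfShift (v t) k) := congrArg (fun z : HSeq => z k) h1
  rw [halfShift_apply, hk.neg_one_zpow] at h2
  have h3 : v t k = -v t k := by simpa using h2
  exact self_eq_neg.1 h3

theorem unweight_initX (ε : ℝ) (k : ℤ) : unweight (initX ε) k
    = ((ε / 2 : ℝ) * (1 - Complex.I)) * (if k = 1 then 1 else 0)
      + ((ε / 2 : ℝ) * (1 + Complex.I)) * (if k = -1 then 1 else 0) := by
  rw [initX, map_add, map_smul, map_smul, lp.coeFn_add, Pi.add_apply, lp.coeFn_smul,
    lp.coeFn_smul, Pi.smul_apply, Pi.smul_apply, unweight_modeX, unweight_modeX, smul_eq_mul,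
    smul_eq_mul]

theorem norm_sq_unweight_initX_one (ε : ℝ) : ‖unweight (initX ε) 1‖ ^ 2 = ε ^ 2 / 2 := by
  rw [unweight_initX, ← Complex.normSq_eq_norm_sq, Complex.normSq_apply]
  simp
  ring

theorem norm_sq_unweight_initX_neg_one (ε : ℝ) : ‖unweight (initX ε) (-1)‖ ^ 2 = ε ^ 2 / 2 := by
  rw [unweight_initX, ← Complex.normSq_eq_norm_sq, Complex.normSq_apply]
  simp
  ring

theorem unweight_initX_of_ne {ε : ℝ} {k : ℤ} (h : k ≠ 1) (h' : k ≠ -1) :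
    unweight (initX ε) k = 0 := by
  rw [unweight_initX, if_neg h, if_neg h', mul_zero, mul_zero, add_zero]

theorem norm_sq_unweight_initX (ε : ℝ) : ‖unweight (initX ε)‖ ^ 2 = ε ^ 2 := by
  have h := hasSum_sum_of_ne_finset_zero (f := fun k => ‖unweight (initX ε) k‖ ^ 2)
    (s := {1, -1})
    (L := SummationFilter.unconditional ℤ) fun k hk => by
      simp only [Finset.mem_insert, Finset.mem_singleton, not_or] at hk
      simp only [unweight_initX_of_ne hk.1 hk.2, norm_zero]; norm_num
  rw [Finset.sum_pair (by norm_num), norm_sq_unweight_initX_one,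
    norm_sq_unweight_initX_neg_one] at h
  rw [(HSeq.hasSum_norm_sq _).unique h]
  ring

theorem norm_sq_initX (ε : ℝ) : ‖initX ε‖ ^ 2 = 2 * ε ^ 2 := by
  have h := hasSum_sum_of_ne_finset_zero (f := fun k => ‖initX ε k‖ ^ 2)
    (s := {1, -1})
    (L := SummationFilter.unconditional ℤ) fun k hk => by
      simp only [Finset.mem_insert, Finset.mem_singleton, not_or] at hk
      rw [← unweight_norm_sq, unweight_initX_of_ne hk.1 hk.2, norm_zero]; ring
  rw [Finset.sum_pair (by norm_num), ← unweight_norm_sq (initX ε) 1,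
    ← unweight_norm_sq (initX ε) (-1),
    norm_sq_unweight_initX_one, norm_sq_unweight_initX_neg_one] at h
  rw [(HSeq.hasSum_norm_sq _).unique h]
  push_cast
  ring

theorem abs_twoCosTwo_le (θ : Circ) : |twoCosTwo θ| ≤ 2 := by
  induction θ using QuotientAddGroup.induction_on with
  | H x =>
    rw [twoCosTwo_coe, abs_mul, abs_two]
    linarith [Real.abs_cos_le_one (2 * x)]

theorem abs_potEnergy_le (x : HSeq) :
    |potEnergy x| ≤ embConst ^ 2 * ‖x‖ ^ 2 * ‖unweight x‖ ^ 2 := by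
  have h2 : ∫ θ, ‖synth x θ‖ ^ 2 ∂haarAddCircle = ‖unweight x‖ ^ 2 := by
    have h := inner_l2Coeff (synth x) (synth x)
    rw [l2Coeff_synth, inner_self_eq_norm_sq_to_K] at h
    have h' : ∫ θ, synth x θ * (starRingEnd ℂ) (synth x θ) ∂haarAddCircle
        = ((∫ θ, ‖synth x θ‖ ^ 2 ∂haarAddCircle : ℝ) : ℂ) := by
      rw [← integral_complex_ofReal]
      refine integral_congr_ae (Eventually.of_forall fun θ => ?_)
      simp only [Complex.mul_conj']
      push_cast
      rfl
    rw [h'] at h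
    refine Complex.ofReal_injective (h.symm.trans ?_)
    exact (Complex.ofReal_pow _ _).symm
  have hi : Integrable (fun θ => embConst ^ 2 * ‖x‖ ^ 2 * ‖synth x θ‖ ^ 2)
      (haarAddCircle (T := 2 * π)) := by
    have hc : Continuous fun θ => embConst ^ 2 * ‖x‖ ^ 2 * ‖synth x θ‖ ^ 2 :=
      (((synth x).continuous.norm).pow 2).const_mul _
    exact hc.integrable_of_hasCompactSupport (HasCompactSupport.of_compactSpace _)
  rw [potEnergy, ← Real.norm_eq_abs, ← h2, ← integral_const_mul]
  refine norm_integral_le_of_norm_le hi (Eventually.of_forall fun θ => ?_)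
  have h3 : ‖synth x θ‖ ≤ embConst * ‖x‖ :=
    ((synth x).norm_coe_le_norm θ).trans (norm_synth_le x)
  have h4 : ‖synth x θ‖ ^ 2 ≤ embConst ^ 2 * ‖x‖ ^ 2 := by
    rw [← mul_pow]; gcongr
  rw [norm_div, norm_mul, Real.norm_eq_abs, norm_pow, norm_norm]
  have h5 := abs_twoCosTwo_le θ
  calc |twoCosTwo θ| * ‖synth x θ‖ ^ 4 / ‖(2 : ℝ)‖
      ≤ 2 * ‖synth x θ‖ ^ 4 / ‖(2 : ℝ)‖ := by gcongr
    _ = ‖synth x θ‖ ^ 2 * ‖synth x θ‖ ^ 2 := by norm_num; ring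
    _ ≤ _ := by gcongr

/-- The projection onto the modes other than `±1`. -/
def offPart : HSeq →L[ℂ] HSeq := mult (fun k => if k = 1 ∨ k = -1 then 0 else 1) (fun k => by
  split_ifs <;> simp)

theorem offPart_apply (x : HSeq) (k : ℤ) :
    offPart x k = if k = 1 ∨ k = -1 then 0 else x k := by
  rw [offPart, mult_apply]; split_ifs <;> simp

theorem norm_sq_eq_add_offPart (x : HSeq) :
    ‖x‖ ^ 2 = ‖x 1‖ ^ 2 + ‖x (-1)‖ ^ 2 + ‖offPart x‖ ^ 2 := by
  have h := hasSum_sum_of_ne_finset_zero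
    (f := fun k => if k = 1 ∨ k = -1 then ‖x k‖ ^ 2 else 0) (s := {1, -1})
    (L := SummationFilter.unconditional ℤ) fun k hk => by
      simp only [Finset.mem_insert, Finset.mem_singleton] at hk
      exact if_neg hk
  rw [Finset.sum_pair (by norm_num)] at h
  simp only [true_or, or_true, if_true] at h
  refine x.hasSum_norm_sq.unique ?_
  convert! h.add (HSeq.hasSum_norm_sq (offPart x)) using 1
  ext k
  rw [offPart_apply]
  split_ifs <;> simp

theorem norm_unweight_freeFlow {t : ℝ} (x : HSeq) :
    ‖unweight (freeFlow t x)‖ = ‖unweight x‖ := by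
  rw [unweight_freeFlow, norm_freeFlow]

theorem IsCurve.mass {α β σ ε : ℝ} {v : ℝ → HSeq} (hv : IsCurve (Icc α β) σ v)
    (h0 : (0 : ℝ) ∈ Icc α β) (hi : v 0 = initX ε) {t : ℝ} (ht : t ∈ Icc α β) :
    ‖unweight (v t)‖ ^ 2 = ε ^ 2 := by
  rw [hv.mass_eq h0 ht, hi, norm_sq_unweight_initX]

/-- Conservation of mass and energy bounds the `H¹` norm for all times. -/
theorem IsCurve.norm_sq_le {α β σ ε : ℝ} {v : ℝ → HSeq} (hv : IsCurve (Icc α β) σ v)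
    (hσ : |σ| = 1) (hε : (embConst * ε) ^ 2 ≤ 1 / 4)
    (h0 : (0 : ℝ) ∈ Icc α β) (hi : v 0 = initX ε) {t : ℝ} (ht : t ∈ Icc α β) :
    ‖v t‖ ^ 2 ≤ 4 * ε ^ 2 ∧ ‖v t‖ ^ 2 ≤ 2 * ε ^ 2 + 6 * embConst ^ 2 * ε ^ 4 := by
  have hE := hv.energy_eq h0 ht
  rw [neg_zero, freeFlow_zero, hi, norm_sq_initX] at hE
  have h1 := abs_potEnergy_le (freeFlow (-t) (v t))
  rw [norm_unweight_freeFlow, norm_freeFlow, hv.mass h0 hi ht] at h1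
  have h2 := abs_potEnergy_le (initX ε)
  rw [norm_sq_initX, norm_sq_unweight_initX] at h2
  have h3 : |σ * potEnergy (initX ε)| ≤ embConst ^ 2 * (2 * ε ^ 2) * ε ^ 2 := by
    rwa [abs_mul, hσ, one_mul]
  have h4 : |σ * potEnergy (freeFlow (-t) (v t))| ≤ embConst ^ 2 * ‖v t‖ ^ 2 * ε ^ 2 := by
    rwa [abs_mul, hσ, one_mul]
  have h5 := (abs_le.1 h3).2
  have h6 := (abs_le.1 h4).1
  -- The potential energy is absorbed into `‖v t‖²`.
  have h7 : (embConst * ε) ^ 2 * ‖v t‖ ^ 2 ≤ 1 / 4 * ‖v t‖ ^ 2 := by gcongr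
  have h8 : (embConst * ε) ^ 2 * ε ^ 2 ≤ 1 / 4 * ε ^ 2 := by gcongr
  have h9 : ‖v t‖ ^ 2 ≤ 4 * ε ^ 2 := by nlinarith [sq_nonneg ε]
  refine ⟨h9, ?_⟩
  have h10 : (embConst * ε) ^ 2 * ‖v t‖ ^ 2 ≤ (embConst * ε) ^ 2 * (4 * ε ^ 2) := by gcongr
  nlinarith

/-- Since `∑ (k² - 1) |ψ̂_k|²` is the difference of two conserved quantities up to the potential
energy, and only odd `k` occur, the modes other than `±1` stay of size `ε²` in `H¹`. -/
theorem IsCurve.offPart_le {α β σ ε : ℝ} {v : ℝ → HSeq} (hv : IsCurve (Icc α β) σ v)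
    (hσ : |σ| = 1) (hε : (embConst * ε) ^ 2 ≤ 1 / 4)
    (h0 : (0 : ℝ) ∈ Icc α β) (hi : v 0 = initX ε) {t : ℝ} (ht : t ∈ Icc α β) :
    ‖offPart (v t)‖ ^ 2 ≤ 8 * embConst ^ 2 * ε ^ 4 := by
  -- `1 + k² - 2 ≥ (4/5) (1 + k²)` for odd `k ≠ ±1`, as then `k² ≥ 9`.
  have h1 : (4 / 5) * ‖offPart (v t)‖ ^ 2 ≤ ‖v t‖ ^ 2 - 2 * ‖unweight (v t)‖ ^ 2 := by
    refine hasSum_le (fun k => ?_) ((HSeq.hasSum_norm_sq (offPart (v t))).mul_left (4 / 5))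
      ((HSeq.hasSum_norm_sq (v t)).sub ((HSeq.hasSum_norm_sq (unweight (v t))).mul_left 2))
    rw [offPart_apply, ← unweight_norm_sq (v t)]
    have hnn := sq_nonneg ‖unweight (v t) k‖
    rcases Int.even_or_odd k with hk | hk
    · have h2 : v t k = 0 := hv.even_modes_eq_zero h0 hi ht hk
      simp [h2]
    · by_cases hk1 : k = 1 ∨ k = -1
      · have hk2 : (k : ℝ) ^ 2 = 1 := by rcases hk1 with h | h <;> simp [h]
        rw [if_pos hk1, hk2]
        norm_num
      · rw [if_neg hk1, ← unweight_norm_sq (v t)]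
        have hk2 : (9 : ℝ) ≤ (k : ℝ) ^ 2 := by
          obtain ⟨j, rfl⟩ := hk
          have : 9 ≤ (2 * j + 1) ^ 2 := by
            rcases le_or_gt 1 j with h | h
            · nlinarith
            · have : j ≤ -2 := by omega
              nlinarith
          exact_mod_cast this
        nlinarith
  have h2 := (hv.norm_sq_le hσ hε h0 hi ht).2
  rw [hv.mass h0 hi ht] at h1
  have : 0 ≤ embConst ^ 2 * ε ^ 4 := by positivity
  linarith

/-! ### Global existence -/

/-- The radial retraction of `ℓ²(ℤ)` onto the ball of radius `R`. -/
def radial (R : ℝ) (x : HSeq) : HSeq := (R / max R ‖x‖) • x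

theorem norm_radial_le {R : ℝ} (hR : 0 < R) (x : HSeq) : ‖radial R x‖ ≤ R := by
  have hm : 0 < max R ‖x‖ := hR.trans_le (le_max_left _ _)
  rw [radial, norm_smul, Real.norm_of_nonneg (by positivity), div_mul_eq_mul_div, div_le_iff₀ hm]
  gcongr
  exact le_max_right _ _

theorem radial_of_norm_le {R : ℝ} (hR : 0 < R) {x : HSeq} (hx : ‖x‖ ≤ R) : radial R x = x := by
  rw [radial, max_eq_left hx, div_self hR.ne', one_smul]

theorem norm_radial_sub_le {R : ℝ} (hR : 0 < R) (x y : HSeq) :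
    ‖radial R x - radial R y‖ ≤ 2 * ‖x - y‖ := by
  have hx : 0 < max R ‖x‖ := hR.trans_le (le_max_left _ _)
  have hy : 0 < max R ‖y‖ := hR.trans_le (le_max_left _ _)
  have e : radial R x - radial R y = (R / max R ‖x‖) • (x - y)
      + ((max R ‖y‖ - max R ‖x‖) * (R / max R ‖x‖) / max R ‖y‖) • y := by
    have : (max R ‖y‖ - max R ‖x‖) * (R / max R ‖x‖) / max R ‖y‖
        = R / max R ‖x‖ - R / max R ‖y‖ := by field_simp
    rw [this, radial, radial, smul_sub, sub_smul]
    abel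
  have h1 : R / max R ‖x‖ ≤ 1 := div_le_one_of_le₀ (le_max_left _ _) hx.le
  have h0 : 0 ≤ R / max R ‖x‖ := by positivity
  have h2 : |max R ‖y‖ - max R ‖x‖| ≤ ‖x - y‖ := by
    rw [max_comm R, max_comm R, abs_sub_comm]
    exact (abs_max_sub_max_le_abs _ _ _).trans (abs_norm_sub_norm_le x y)
  have h3 : ‖y‖ / max R ‖y‖ ≤ 1 := div_le_one_of_le₀ (le_max_right _ _) hy.le
  rw [e]
  refine (norm_add_le _ _).trans ?_
  rw [norm_smul, norm_smul, Real.norm_of_nonneg h0, norm_div, norm_mul, Real.norm_of_nonneg h0,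
    Real.norm_of_nonneg hy.le, Real.norm_eq_abs]
  calc R / max R ‖x‖ * ‖x - y‖ + |max R ‖y‖ - max R ‖x‖| * (R / max R ‖x‖) / max R ‖y‖ * ‖y‖
      = R / max R ‖x‖ * ‖x - y‖
        + |max R ‖y‖ - max R ‖x‖| * (R / max R ‖x‖) * (‖y‖ / max R ‖y‖) := by ring
    _ ≤ 1 * ‖x - y‖ + ‖x - y‖ * 1 * 1 := by gcongr
    _ = 2 * ‖x - y‖ := by ring

/-- The vector field of the interaction picture, with the nonlinearity truncated outside the ball
of radius `R`. It is bounded and globally Lipschitz. -/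
def cutField (σ R t : ℝ) (v : HSeq) : HSeq :=
  (-(Complex.I * σ)) • freeFlow t (cubic (radial R (freeFlow (-t) v)))

theorem cutField_eq {σ R t : ℝ} (hR : 0 < R) {v : HSeq} (hv : ‖v‖ ≤ R) :
    cutField σ R t v = nlsField σ t v := by
  rw [cutField, nlsField, radial_of_norm_le hR (by rwa [norm_freeFlow])]

theorem cubic_zero : cubic 0 = 0 := by
  refine synth_injective (ContinuousMap.ext fun θ => ?_)
  simp [synth_cubic, nonlin]

theorem norm_cutField_le {σ R : ℝ} (hR : 0 < R) (t : ℝ) (v : HSeq) :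
    ‖cutField σ R t v‖ ≤ |σ| * (cubConst * R ^ 2 * R) := by
  have h := norm_cubic_sub_le (radial R (freeFlow (-t) v)) 0
  rw [cubic_zero, sub_zero, norm_zero, add_zero, sub_zero] at h
  have h1 := norm_radial_le hR (freeFlow (-t) v)
  rw [cutField, norm_smul, norm_freeFlow, norm_neg, norm_mul, Complex.norm_I, one_mul,
    Complex.norm_real, Real.norm_eq_abs]
  have := cubConst_nonneg
  refine mul_le_mul_of_nonneg_left (h.trans ?_) (abs_nonneg σ)
  gcongr

theorem norm_cutField_sub_le {σ R : ℝ} (hR : 0 < R) (t : ℝ) (v w : HSeq) :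
    ‖cutField σ R t v - cutField σ R t w‖ ≤ |σ| * (cubConst * (R + R) ^ 2 * 2) * ‖v - w‖ := by
  have h := norm_cubic_sub_le (radial R (freeFlow (-t) v)) (radial R (freeFlow (-t) w))
  have h1 := norm_radial_le hR (freeFlow (-t) v)
  have h2 := norm_radial_le hR (freeFlow (-t) w)
  have h3 := norm_radial_sub_le hR (freeFlow (-t) v) (freeFlow (-t) w)
  rw [← map_sub, norm_freeFlow] at h3
  rw [cutField, cutField, ← smul_sub, ← map_sub, norm_smul, norm_freeFlow, norm_neg, norm_mul,
    Complex.norm_I, one_mul, Complex.norm_real, Real.norm_eq_abs, mul_assoc]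
  have := cubConst_nonneg
  refine mul_le_mul_of_nonneg_left (h.trans ?_) (abs_nonneg σ)
  calc _ ≤ cubConst * (R + R) ^ 2 * (2 * ‖v - w‖) := by gcongr
    _ = _ := by ring

theorem continuous_cutField {σ R : ℝ} (hR : 0 < R) (v : HSeq) :
    Continuous fun t => cutField σ R t v := by
  have hr : Continuous (radial R) := by
    refine (LipschitzWith.of_dist_le_mul (K := 2) fun x y => ?_).continuous
    rw [dist_eq_norm, dist_eq_norm]
    exact norm_radial_sub_le hR x y
  have h1 : Continuous fun t : ℝ => freeFlow (-t) v :=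
    continuous_freeFlow.comp (continuous_neg.prodMk continuous_const)
  have h2 : Continuous fun t : ℝ => cubic (radial R (freeFlow (-t) v)) :=
    continuous_cubic.comp (hr.comp h1)
  have h3 : Continuous fun t : ℝ => freeFlow t (cubic (radial R (freeFlow (-t) v))) :=
    continuous_freeFlow.comp (continuous_id.prodMk h2)
  exact h3.const_smul (-(Complex.I * σ))

theorem exists_cutField_curve {σ R T : ℝ} (hR : 0 < R) (hT : 0 ≤ T) (x₀ : HSeq) :
    ∃ v : ℝ → HSeq, v 0 = x₀ ∧
      ∀ t ∈ Icc (-T) T, HasDerivWithinAt v (cutField σ R t (v t)) (Icc (-T) T) t := by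
  have hc := cubConst_nonneg
  have hL : 0 ≤ |σ| * (cubConst * R ^ 2 * R) := by positivity
  have hK : 0 ≤ |σ| * (cubConst * (R + R) ^ 2 * 2) := by positivity
  let L : NNReal := ⟨_, hL⟩
  let K : NNReal := ⟨_, hK⟩
  -- The field is bounded and Lipschitz everywhere, so the ball may have radius `L T`.
  have hP : IsPicardLindelof (cutField σ R) (tmin := -T) (tmax := T)
      ⟨0, neg_nonpos.2 hT, hT⟩ x₀ (L * ⟨T, hT⟩) 0 L K :=
    { lipschitzOnWith := fun t _ => LipschitzOnWith.of_dist_le_mul fun x _ y _ => by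
        rw [dist_eq_norm, dist_eq_norm]
        exact norm_cutField_sub_le hR t x y
      continuousOn := fun x _ => (continuous_cutField hR x).continuousOn
      norm_le := fun t _ x _ => norm_cutField_le hR t x
      mul_max_le := by
        rw [sub_zero, zero_sub, neg_neg, max_self, NNReal.coe_zero, sub_zero]
        exact le_rfl }
  exact hP.exists_eq_forall_mem_Icc_hasDerivWithinAt₀

/-- Continuity argument: a bound by `R` that improves itself to a bound by `r < R` on symmetric
intervals holds everywhere. -/
theorem le_of_improving_bound {g : ℝ → ℝ} {T R r : ℝ} (hg : ContinuousOn g (Icc (-T) T))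
    (hT : 0 ≤ T) (hrR : r < R) (h0 : g 0 ≤ r)
    (h : ∀ a ∈ Icc 0 T, (∀ s ∈ Icc (-a) a, g s ≤ R) → ∀ s ∈ Icc (-a) a, g s ≤ r) :
    ∀ s ∈ Icc (-T) T, g s ≤ r := by
  by_contra! hcon
  obtain ⟨s₀, hs₀, hgs₀⟩ := hcon
  have hne : ({s ∈ Icc (-T) T | R ≤ g s}).Nonempty := by
    by_contra hemp
    rw [not_nonempty_iff_eq_empty] at hemp
    refine hgs₀.not_ge (h T ⟨hT, le_rfl⟩ (fun s hs => ?_) s₀ hs₀)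
    by_contra hs'
    exact (Set.eq_empty_iff_forall_notMem.1 hemp s) ⟨hs, (not_le.1 hs').le⟩
  have hcpt : IsCompact {s ∈ Icc (-T) T | R ≤ g s} :=
    isCompact_Icc.of_isClosed_subset
      (hg.preimage_isClosed_of_isClosed isClosed_Icc isClosed_Ici) (fun s hs => hs.1)
  obtain ⟨c, hc, hmin⟩ := hcpt.exists_isMinOn hne continuous_abs.continuousOn
  -- `c` is a time of smallest modulus at which the bound by `R` is reached.
  have hlt : ∀ s, |s| < |c| → g s ≤ r := by
    intro s hs
    have hcT : |c| ≤ T := abs_le.2 hc.1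
    refine h |s| ⟨abs_nonneg s, hs.le.trans hcT⟩ (fun s' hs' => ?_) s ⟨neg_abs_le s, le_abs_self s⟩
    by_contra hs''
    have h1 : |s'| ≤ |s| := abs_le.2 hs'
    have h2 : s' ∈ {s ∈ Icc (-T) T | R ≤ g s} :=
      ⟨abs_le.1 (h1.trans (hs.le.trans hcT)), (not_le.1 hs'').le⟩
    exact absurd (hmin h2) (not_le.2 (h1.trans_lt hs))
  have hc0 : c ≠ 0 := by
    rintro rfl
    exact absurd hc.2 (not_le.2 (h0.trans_lt hrR))
  have hcont : ContinuousWithinAt (fun θ : ℝ => g (θ * c)) (Ico 0 1) 1 := by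
    have hmaps : MapsTo (fun θ : ℝ => θ * c) (Icc 0 1) (Icc (-T) T) := fun θ hθ => by
      refine abs_le.1 ?_
      rw [abs_mul, abs_of_nonneg hθ.1]
      exact (mul_le_of_le_one_left (abs_nonneg c) hθ.2).trans (abs_le.2 hc.1)
    have h1 : ContinuousOn (fun θ : ℝ => g (θ * c)) (Icc 0 1) :=
      hg.comp (by fun_prop) hmaps
    exact (h1 1 (right_mem_Icc.2 zero_le_one)).mono Ico_subset_Icc_self
  have hne' : (𝓝[Ico (0 : ℝ) 1] 1).NeBot := by
    rw [← mem_closure_iff_nhdsWithin_neBot, closure_Ico zero_ne_one]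
    exact right_mem_Icc.2 zero_le_one
  have hgc : g (1 * c) ≤ r := by
    refine le_of_tendsto hcont.tendsto ?_
    filter_upwards [self_mem_nhdsWithin] with θ hθ
    refine hlt _ ?_
    rw [abs_mul, abs_of_nonneg hθ.1]
    exact mul_lt_of_lt_one_left (abs_pos.2 hc0) hθ.2
  rw [one_mul] at hgc
  linarith [hc.2]

/-- Global existence on any symmetric interval, from the truncated equation and the bound of the
`H¹` norm by `2ε`, which shows that the truncation at radius `3ε` is never active. -/
theorem exists_isCurve {σ ε T : ℝ} (hσ : |σ| = 1) (hε0 : 0 < ε)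
    (hε : (embConst * ε) ^ 2 ≤ 1 / 4) (hT : 0 ≤ T) :
    ∃ v : ℝ → HSeq, v 0 = initX ε ∧ IsCurve (Icc (-T) T) σ v := by
  have hR : 0 < 3 * ε := by positivity
  obtain ⟨v, hv0, hv⟩ := exists_cutField_curve (σ := σ) hR hT (initX ε)
  have hcurve : ∀ a ∈ Icc 0 T, (∀ s ∈ Icc (-a) a, ‖v s‖ ≤ 3 * ε) → IsCurve (Icc (-a) a) σ v := by
    intro a ha hb t ht
    have hsub : Icc (-a) a ⊆ Icc (-T) T := Icc_subset_Icc (neg_le_neg ha.2) ha.2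
    rw [← cutField_eq hR (hb t ht)]
    exact (hv t (hsub ht)).mono hsub
  have hbound : ∀ a ∈ Icc 0 T, (∀ s ∈ Icc (-a) a, ‖v s‖ ≤ 3 * ε) →
      ∀ s ∈ Icc (-a) a, ‖v s‖ ≤ 2 * ε := by
    intro a ha hb s hs
    have h1 := ((hcurve a ha hb).norm_sq_le hσ hε ⟨neg_nonpos.2 ha.1, ha.1⟩ hv0 hs).1
    exact le_of_sq_le_sq (by linarith [mul_pow 2 ε 2]) (by positivity)
  have h0 : ‖v 0‖ ≤ 2 * ε := by
    rw [hv0]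
    refine le_of_sq_le_sq ?_ (by positivity)
    rw [norm_sq_initX]
    nlinarith
  have hall := le_of_improving_bound (g := fun t => ‖v t‖)
    (fun t ht => (hv t ht).continuousWithinAt.norm) hT (by linarith) h0 hbound
  exact ⟨v, hv0, hcurve T ⟨hT, le_rfl⟩ fun s hs => (hall s hs).trans (by linarith)⟩

/-! ### The two-mode system -/

/-- The function `a e^{ix} + b e^{-ix}`, in weighted coefficients. -/
def twoModes (a b : ℂ) : HSeq := a • modeX 1 + b • modeX (-1)

theorem fourier_eq_zpow (n : ℤ) (θ : Circ) : fourier n θ = (fourier 1 θ : ℂ) ^ n := by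
  rw [fourier_apply, fourier_one, toCircle_zsmul]
  simp

theorem cubic_twoModes (a b : ℂ) : cubic (twoModes a b)
    = (a ^ 2 * conj b) • modeX 5 + ((a * conj a + 2 * (b * conj b)) * a) • modeX 3
      + ((a * conj b + b * conj a) * a + (a * conj a + b * conj b) * b) • modeX 1
      + ((a * conj b + b * conj a) * b + (a * conj a + b * conj b) * a) • modeX (-1)
      + ((2 * (a * conj a) + b * conj b) * b) • modeX (-3)
      + (conj a * b ^ 2) • modeX (-5) := by
  refine synth_injective (ContinuousMap.ext fun θ => ?_)
  simp only [cubic, twoModes, potX, synth_mulX, synth_starX, map_add, map_smul, synth_modeX,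
    ContinuousMap.mul_apply, ContinuousMap.add_apply, ContinuousMap.smul_apply,
    ContinuousMap.star_apply, star_smul, smul_eq_mul, RCLike.star_def]
  rw [← fourier_neg, ← fourier_neg, neg_neg]
  rw [fourier_eq_zpow 5, fourier_eq_zpow 3, fourier_eq_zpow 2, fourier_eq_zpow (-1),
    fourier_eq_zpow (-2), fourier_eq_zpow (-3), fourier_eq_zpow (-5)]
  have hE : (fourier 1 θ : ℂ) ≠ 0 := by
    rw [fourier_one]; exact Circle.coe_ne_zero _
  generalize (fourier 1 θ : ℂ) = E at *
  simp only [zpow_neg, zpow_ofNat]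
  field_simp
  ring

theorem unweight_twoModes (a b : ℂ) (k : ℤ) : unweight (twoModes a b) k
    = a * (if k = 1 then 1 else 0) + b * (if k = -1 then 1 else 0) := by
  rw [twoModes, map_add, map_smul, map_smul, lp.coeFn_add, Pi.add_apply, lp.coeFn_smul,
    lp.coeFn_smul, Pi.smul_apply, Pi.smul_apply, unweight_modeX, unweight_modeX, smul_eq_mul,
    smul_eq_mul]

theorem unweight_cubic_twoModes_one (a b : ℂ) : unweight (cubic (twoModes a b)) 1
    = (a * conj b + b * conj a) * a + (a * conj a + b * conj b) * b := by
  rw [cubic_twoModes]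
  simp only [map_add, map_smul, lp.coeFn_add, Pi.add_apply, lp.coeFn_smul, Pi.smul_apply,
    unweight_modeX, smul_eq_mul]
  norm_num

theorem unweight_cubic_twoModes_neg_one (a b : ℂ) : unweight (cubic (twoModes a b)) (-1)
    = (a * conj b + b * conj a) * b + (a * conj a + b * conj b) * a := by
  rw [cubic_twoModes]
  simp only [map_add, map_smul, lp.coeFn_add, Pi.add_apply, lp.coeFn_smul, Pi.smul_apply,
    unweight_modeX, smul_eq_mul]
  norm_num

theorem sub_twoModes (x : HSeq) :
    x - twoModes (unweight x 1) (unweight x (-1)) = offPart x := by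
  refine unweight_injective ?_
  ext k
  have h : unweight (offPart x) k = if k = 1 ∨ k = -1 then 0 else unweight x k := by
    rw [unweight_apply, offPart_apply, unweight_apply]; split_ifs <;> simp
  rw [map_sub, lp.coeFn_sub, Pi.sub_apply, unweight_twoModes, h]
  by_cases h1 : k = 1
  · subst h1; norm_num
  · by_cases h2 : k = -1
    · subst h2; norm_num
    · simp [h1, h2]

theorem norm_unweight_apply_le (x : HSeq) (k : ℤ) : ‖unweight x k‖ ≤ ‖x‖ :=
  (lp.norm_apply_le_norm two_ne_zero _ k).trans (norm_unweight_le x)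

theorem norm_unweight_cubic_sub_le (x : HSeq) (k : ℤ) :
    ‖unweight (cubic x) k - unweight (cubic (twoModes (unweight x 1) (unweight x (-1)))) k‖
      ≤ cubConst * (3 * ‖x‖) ^ 2 * ‖offPart x‖ := by
  set u := twoModes (unweight x 1) (unweight x (-1))
  have h1 : unweight (cubic x) k - unweight (cubic u) k = unweight (cubic x - cubic u) k := by
    rw [map_sub, lp.coeFn_sub, Pi.sub_apply]
  have hu : ‖u‖ ≤ 2 * ‖x‖ := by
    have : u = x - offPart x := by rw [← sub_twoModes, sub_sub_cancel]
    rw [this]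
    have h2 : ‖offPart x‖ ≤ ‖x‖ := norm_mult_le _ _ x
    linarith [norm_sub_le x (offPart x)]
  have := cubConst_nonneg
  rw [h1, ← sub_twoModes]
  refine (norm_unweight_apply_le _ k).trans ((norm_cubic_sub_le x u).trans ?_)
  gcongr
  linarith

theorem norm_offPart_freeFlow (t : ℝ) (x : HSeq) : ‖offPart (freeFlow t x)‖ = ‖offPart x‖ := by
  have : offPart (freeFlow t x) = freeFlow t (offPart x) := by
    ext k
    simp only [offPart_apply, freeFlow_apply]
    split_ifs <;> simp
  rw [this, norm_freeFlow]

theorem norm_offPart_unweight_le (x : HSeq) : ‖offPart (unweight x)‖ ≤ ‖offPart x‖ := by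
  have : offPart (unweight x) = unweight (offPart x) := by
    ext k
    rw [offPart_apply, unweight_apply, unweight_apply, offPart_apply]
    split_ifs <;> simp
  rw [this]
  exact norm_unweight_le _

theorem unweight_freeFlow_one (t : ℝ) (x : HSeq) :
    unweight (freeFlow t x) 1 = Complex.exp (t * Complex.I) * unweight x 1 := by
  rw [unweight_freeFlow, freeFlow_apply]; norm_num

theorem unweight_freeFlow_neg_one (t : ℝ) (x : HSeq) :
    unweight (freeFlow t x) (-1) = Complex.exp (t * Complex.I) * unweight x (-1) := by
  rw [unweight_freeFlow, freeFlow_apply]; norm_num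

theorem exp_mul_conj_exp (t : ℝ) :
    Complex.exp (t * Complex.I) * conj (Complex.exp (t * Complex.I)) = 1 := by
  rw [Complex.mul_conj', Complex.norm_exp_ofReal_mul_I]; norm_num

/-- The equation for the two modes `±1`: the two-mode system up to an error controlled by the
other modes. -/
theorem IsCurve.exists_hasDerivWithinAt_modes {J : Set ℝ} {σ t : ℝ} {v : ℝ → HSeq}
    (hv : IsCurve J σ v) (ht : t ∈ J) {p q : ℂ} (hp : p = unweight (v t) 1)
    (hq : q = unweight (v t) (-1)) :
    ∃ r₁ r₂ : ℂ, ‖r₁‖ ≤ cubConst * (3 * ‖v t‖) ^ 2 * ‖offPart (v t)‖ ∧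
      ‖r₂‖ ≤ cubConst * (3 * ‖v t‖) ^ 2 * ‖offPart (v t)‖ ∧
      HasDerivWithinAt (fun s => unweight (v s) 1) (-(Complex.I * σ)
        * ((p * conj q + q * conj p) * p + (p * conj p + q * conj q) * q + r₁)) J t ∧
      HasDerivWithinAt (fun s => unweight (v s) (-1)) (-(Complex.I * σ)
        * ((p * conj q + q * conj p) * q + (p * conj p + q * conj q) * p + r₂)) J t := by
  obtain ⟨x, hx⟩ : ∃ x, x = freeFlow (-t) (v t) := ⟨_, rfl⟩
  have hvx : v t = freeFlow t x := by rw [hx, freeFlow_freeFlow, add_neg_cancel, freeFlow_zero]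
  have hd : HasDerivWithinAt (fun r => unweight (v r)) (unweight (nlsField σ t (v t))) J t :=
    (unweight.restrictScalars ℝ).hasFDerivAt.comp_hasDerivWithinAt t (hv t ht)
  have hn : nlsField σ t (v t) = (-(Complex.I * σ)) • freeFlow t (cubic x) := by
    rw [nlsField, ← hx]
  have hn₁ : unweight (nlsField σ t (v t)) 1
      = -(Complex.I * σ) * (Complex.exp (t * Complex.I) * unweight (cubic x) 1) := by
    rw [hn, map_smul, lp.coeFn_smul, Pi.smul_apply, unweight_freeFlow_one, smul_eq_mul]
  have hn₂ : unweight (nlsField σ t (v t)) (-1)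
      = -(Complex.I * σ) * (Complex.exp (t * Complex.I) * unweight (cubic x) (-1)) := by
    rw [hn, map_smul, lp.coeFn_smul, Pi.smul_apply, unweight_freeFlow_neg_one, smul_eq_mul]
  have hE := exp_mul_conj_exp t
  have hE1 : ‖Complex.exp (t * Complex.I)‖ = 1 := Complex.norm_exp_ofReal_mul_I t
  have b₁ := norm_unweight_cubic_sub_le x 1
  have b₂ := norm_unweight_cubic_sub_le x (-1)
  rw [unweight_cubic_twoModes_one] at b₁
  rw [unweight_cubic_twoModes_neg_one] at b₂
  rw [hvx, unweight_freeFlow_one] at hp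
  rw [hvx, unweight_freeFlow_neg_one] at hq
  have hnv : ‖v t‖ = ‖x‖ := by rw [hvx, norm_freeFlow]
  have hov : ‖offPart (v t)‖ = ‖offPart x‖ := by rw [hvx, norm_offPart_freeFlow]
  rw [hnv, hov]
  generalize Complex.exp (t * Complex.I) = E at *
  generalize ha : unweight x 1 = a at *
  generalize hb : unweight x (-1) = b at *
  refine ⟨_, _, (norm_mul E _).trans_le ((mul_le_mul_of_nonneg_right hE1.le
    (norm_nonneg _)).trans ((one_mul _).trans_le b₁)),
    (norm_mul E _).trans_le ((mul_le_mul_of_nonneg_right hE1.le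
    (norm_nonneg _)).trans ((one_mul _).trans_le b₂)), ?_, ?_⟩
  · refine (HSeq.hasDerivWithinAt_apply hd 1).congr_deriv ?_
    rw [hn₁, hp, hq]
    simp only [map_mul]
    linear_combination (Complex.I * σ * E
      * ((a * conj b + b * conj a) * a + (a * conj a + b * conj b) * b)) * hE
  · refine (HSeq.hasDerivWithinAt_apply hd (-1)).congr_deriv ?_
    rw [hn₂, hp, hq]
    simp only [map_mul]
    linear_combination (Complex.I * σ * E
      * ((a * conj b + b * conj a) * b + (a * conj a + b * conj b) * a)) * hE

/-- The complex variable `2 Im(p̄ q) + iσ(|p|² - |q|²)`, which rotates under the two-mode system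
with angular velocity `2 (|p|² + |q|²)`. -/
def rotor (σ : ℝ) (p q : ℂ) : ℂ :=
  -Complex.I * (conj p * q - p * conj q) + Complex.I * σ * (p * conj p - q * conj q)

theorem rotor_im (σ : ℝ) (p q : ℂ) : (rotor σ p q).im = σ * (‖p‖ ^ 2 - ‖q‖ ^ 2) := by
  rw [← Complex.normSq_eq_norm_sq, ← Complex.normSq_eq_norm_sq, Complex.normSq_apply,
    Complex.normSq_apply, rotor]
  simp

theorem norm_rotor_le {σ ε : ℝ} (hσ : |σ| = 1) {p q : ℂ} (hp : ‖p‖ ≤ ε) (hq : ‖q‖ ≤ ε) :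
    ‖rotor σ p q‖ ≤ 4 * ε ^ 2 := by
  have h0 : 0 ≤ ε := (norm_nonneg p).trans hp
  have h1 : ‖-Complex.I * (conj p * q - p * conj q)‖ ≤ 2 * ε ^ 2 := by
    rw [norm_mul, norm_neg, Complex.norm_I, one_mul]
    refine (norm_sub_le _ _).trans ?_
    rw [norm_mul, norm_mul, RCLike.norm_conj, RCLike.norm_conj]
    nlinarith [mul_le_mul hp hq (norm_nonneg q) h0]
  have h2 : ‖Complex.I * σ * (p * conj p - q * conj q)‖ ≤ 2 * ε ^ 2 := by
    rw [norm_mul, norm_mul, Complex.norm_I, one_mul, Complex.norm_real, Real.norm_eq_abs, hσ,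
      one_mul]
    refine (norm_sub_le _ _).trans ?_
    rw [norm_mul, norm_mul, RCLike.norm_conj, RCLike.norm_conj]
    nlinarith [mul_le_mul hp hp (norm_nonneg p) h0, mul_le_mul hq hq (norm_nonneg q) h0]
  exact (norm_add_le _ _).trans (by linarith)

theorem hasDerivWithinAt_rotor {σ : ℝ} {f g : ℝ → ℂ} {f' g' : ℂ} {J : Set ℝ} {t : ℝ}
    (hf : HasDerivWithinAt f f' J t) (hg : HasDerivWithinAt g g' J t) :
    HasDerivWithinAt (fun s => rotor σ (f s) (g s))
      (-Complex.I * (conj f' * g t + conj (f t) * g' - (f' * conj (g t) + f t * conj g'))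
        + Complex.I * σ * (f' * conj (f t) + f t * conj f' - (g' * conj (g t) + g t * conj g')))
      J t := by
  have cf : HasDerivWithinAt (fun s => conj (f s)) (conj f') J t :=
    Complex.conjCLE.hasFDerivAt.comp_hasDerivWithinAt t hf
  have cg : HasDerivWithinAt (fun s => conj (g s)) (conj g') J t :=
    Complex.conjCLE.hasFDerivAt.comp_hasDerivWithinAt t hg
  exact (((cf.mul hg).sub (hf.mul cg)).const_mul (-Complex.I)).add
    (((hf.mul cf).sub (hg.mul cg)).const_mul (Complex.I * σ))

/-- The error in the rotation of `rotor` caused by perturbations `r₁`, `r₂` of the two-mode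
system. -/
theorem norm_rotor_error_le {σ R ε : ℝ} (hσ : |σ| = 1) {p q r₁ r₂ f' g' : ℂ} (hp : ‖p‖ ≤ ε)
    (hq : ‖q‖ ≤ ε) (h₁ : ‖r₁‖ ≤ R) (h₂ : ‖r₂‖ ≤ R)
    (hf : f' = -(Complex.I * σ)
        * ((p * conj q + q * conj p) * p + (p * conj p + q * conj q) * q + r₁))
    (hg : g' = -(Complex.I * σ)
        * ((p * conj q + q * conj p) * q + (p * conj p + q * conj q) * p + r₂)) :
    ‖-Complex.I * (conj f' * q + conj p * g' - (f' * conj q + p * conj g'))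
        + Complex.I * σ * (f' * conj p + p * conj f' - (g' * conj q + q * conj g'))
      - 2 * Complex.I * (‖p‖ ^ 2 + ‖q‖ ^ 2 : ℝ) * rotor σ p q‖ ≤ 8 * R * ε := by
  have hσ2 : (σ : ℂ) ^ 2 = 1 := by
    rw [← Complex.ofReal_pow, ← sq_abs, hσ]; norm_num
  have hε : 0 ≤ ε := (norm_nonneg p).trans hp
  have hR : 0 ≤ R := (norm_nonneg r₁).trans h₁
  have hm : ((‖p‖ ^ 2 + ‖q‖ ^ 2 : ℝ) : ℂ) = p * conj p + q * conj q := by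
    rw [Complex.mul_conj', Complex.mul_conj']; push_cast; rfl
  have e : -Complex.I * (conj f' * q + conj p * g' - (f' * conj q + p * conj g'))
        + Complex.I * σ * (f' * conj p + p * conj f' - (g' * conj q + q * conj g'))
      - 2 * Complex.I * (‖p‖ ^ 2 + ‖q‖ ^ 2 : ℝ) * rotor σ p q
      = σ * (conj r₁ * q - conj p * r₂ + r₁ * conj q - p * conj r₂)
        + (r₁ * conj p - p * conj r₁ - r₂ * conj q + q * conj r₂) := by
    rw [hm, hf, hg, rotor]
    simp only [map_mul, map_add, map_neg, Complex.conj_I, Complex.conj_ofReal, Complex.conj_conj]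
    have hI := Complex.I_sq
    generalize conj p = p' at *
    generalize conj q = q' at *
    generalize conj r₁ = r₁' at *
    generalize conj r₂ = r₂' at *
    set m := p * p' + q * q'
    set φ := (p * q' + q * p') * p + m * q + r₁
    set φ' := (p' * q + q' * p) * p' + (p' * p + q' * q) * q' + r₁'
    set γ := (p * q' + q * p') * q + m * p + r₂
    set γ' := (p' * q + q' * p) * q' + (p' * p + q' * q) * p' + r₂'
    set B := -φ * p' + p * φ' + γ * q' - q * γ'
    linear_combination (-σ * (φ' * q - p' * γ + φ * q' - p * γ') + σ ^ 2 * B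
      + 2 * m * (p' * q - p * q') - 2 * m * σ * (p * p' - q * q')) * hI - B * hσ2
  have hb {a b : ℂ} (ha : ‖a‖ ≤ ε) (hb : ‖b‖ ≤ R) : ‖a * conj b‖ ≤ R * ε ∧ ‖b * conj a‖ ≤ R * ε
      ∧ ‖conj b * a‖ ≤ R * ε ∧ ‖conj a * b‖ ≤ R * ε := by
    simp only [norm_mul, RCLike.norm_conj]
    have := mul_le_mul hb ha (norm_nonneg a) hR
    refine ⟨?_, ?_, ?_, ?_⟩ <;> linarith
  rw [e]
  have hσ' : ‖(σ : ℂ)‖ = 1 := by rw [Complex.norm_real, Real.norm_eq_abs, hσ]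
  refine (norm_add_le _ _).trans ?_
  rw [norm_mul, hσ', one_mul]
  have k1 := norm_sub_le (conj r₁ * q - conj p * r₂ + r₁ * conj q) (p * conj r₂)
  have k2 := norm_add_le (conj r₁ * q - conj p * r₂) (r₁ * conj q)
  have k3 := norm_sub_le (conj r₁ * q) (conj p * r₂)
  have k4 := norm_add_le (r₁ * conj p - p * conj r₁ - r₂ * conj q) (q * conj r₂)
  have k5 := norm_sub_le (r₁ * conj p - p * conj r₁) (r₂ * conj q)
  have k6 := norm_sub_le (r₁ * conj p) (p * conj r₁)
  obtain ⟨a1, a2, a3, a4⟩ := hb hp h₁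
  obtain ⟨b1, b2, b3, b4⟩ := hb hp h₂
  obtain ⟨c1, c2, c3, c4⟩ := hb hq h₁
  obtain ⟨d1, d2, d3, d4⟩ := hb hq h₂
  linarith

/-- The constant in the estimate of the difference of the two modes: `864 = 8 · 108` comes from the
influence of the other modes on the modes `±1`, and `64` from replacing the angular velocity
`2(|p|² + |q|²)` by `2ε²`. -/
def beatConst : ℝ := 864 * cubConst * embConst + 64 * embConst ^ 2

theorem IsCurve.sum_modes {α β σ ε : ℝ} {v : ℝ → HSeq} (hv : IsCurve (Icc α β) σ v)
    (hσ : |σ| = 1) (hε : (embConst * ε) ^ 2 ≤ 1 / 4)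
    (h0 : (0 : ℝ) ∈ Icc α β) (hi : v 0 = initX ε) {t : ℝ} (ht : t ∈ Icc α β) :
    |‖unweight (v t) 1‖ ^ 2 + ‖unweight (v t) (-1)‖ ^ 2 - ε ^ 2| ≤ 8 * embConst ^ 2 * ε ^ 4 := by
  have h1 := norm_sq_eq_add_offPart (unweight (v t))
  rw [hv.mass h0 hi ht] at h1
  have h2 := hv.offPart_le hσ hε h0 hi ht
  have h3 : ‖offPart (unweight (v t))‖ ^ 2 ≤ ‖offPart (v t)‖ ^ 2 := by
    have := norm_offPart_unweight_le (v t)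
    gcongr
  rw [abs_le]
  constructor
  · linarith
  · have : 0 ≤ embConst ^ 2 * ε ^ 4 := by positivity
    linarith [sq_nonneg ‖offPart (unweight (v t))‖]

theorem rotor_init (σ ε : ℝ) :
    rotor σ (unweight (initX ε) 1) (unweight (initX ε) (-1)) = (ε ^ 2 : ℝ) := by
  rw [unweight_initX, unweight_initX, rotor]
  have hI := Complex.I_sq
  norm_num [map_ofNat]
  linear_combination (-(ε : ℂ) ^ 2) * hI

theorem IsCurve.diff_modes {α β σ ε : ℝ} {v : ℝ → HSeq} (hv : IsCurve (Icc α β) σ v)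
    (hσ : |σ| = 1) (hε0 : 0 ≤ ε) (hε1 : ε ≤ 1) (hε : (embConst * ε) ^ 2 ≤ 1 / 4)
    (h0 : (0 : ℝ) ∈ Icc α β) (hi : v 0 = initX ε) {t : ℝ} (ht : t ∈ Icc α β) :
    |‖unweight (v t) 1‖ ^ 2 - ‖unweight (v t) (-1)‖ ^ 2
      - σ * (ε ^ 2 * Real.sin (2 * ε ^ 2 * t))| ≤ beatConst * ε ^ 5 * |t| := by
  have hA := embConst_nonneg
  have hc := cubConst_nonneg
  -- In the frame rotating with angular velocity `2ε²` the variable `rotor` is almost constant.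
  have hderiv : ∀ s ∈ Icc α β, ∃ w' : ℂ, ‖w'‖ ≤ beatConst * ε ^ 5 ∧
      HasDerivWithinAt (fun s => Complex.exp ((-(2 * ε ^ 2) * s : ℝ) * Complex.I)
        * rotor σ (unweight (v s) 1) (unweight (v s) (-1))) w' (Icc α β) s := by
    intro s hs
    obtain ⟨p, hp⟩ : ∃ p, p = unweight (v s) 1 := ⟨_, rfl⟩
    obtain ⟨q, hq⟩ : ∃ q, q = unweight (v s) (-1) := ⟨_, rfl⟩
    obtain ⟨r₁, r₂, hr₁, hr₂, hf, hg⟩ := hv.exists_hasDerivWithinAt_modes hs hp hq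
    have hz := hasDerivWithinAt_rotor (σ := σ) hf hg
    rw [← hp, ← hq] at hz
    refine ⟨_, ?_, (hasDerivWithinAt_phase (-(2 * ε ^ 2)) _ s).mul hz⟩
    have hmass := hv.mass h0 hi hs
    have hnp : ‖p‖ ≤ ε := by
      rw [hp]
      refine (lp.norm_apply_le_norm two_ne_zero _ 1).trans (le_of_sq_le_sq hmass.le hε0)
    have hnq : ‖q‖ ≤ ε := by
      rw [hq]
      refine (lp.norm_apply_le_norm two_ne_zero _ (-1)).trans (le_of_sq_le_sq hmass.le hε0)
    have hoff : ‖offPart (v s)‖ ≤ 3 * embConst * ε ^ 2 := by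
      refine le_of_sq_le_sq ((hv.offPart_le hσ hε h0 hi hs).trans ?_) (by positivity)
      have : 0 ≤ embConst ^ 2 * ε ^ 4 := by positivity
      linarith [show (3 * embConst * ε ^ 2) ^ 2 = 9 * (embConst ^ 2 * ε ^ 4) by ring]
    have hnv : ‖v s‖ ≤ 2 * ε := by
      refine le_of_sq_le_sq ((hv.norm_sq_le hσ hε h0 hi hs).1.trans_eq (by ring)) (by positivity)
    have hR : cubConst * (3 * ‖v s‖) ^ 2 * ‖offPart (v s)‖
        ≤ 108 * cubConst * embConst * ε ^ 4 := by
      calc cubConst * (3 * ‖v s‖) ^ 2 * ‖offPart (v s)‖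
          ≤ cubConst * (3 * (2 * ε)) ^ 2 * (3 * embConst * ε ^ 2) := by gcongr
        _ = _ := by ring
    have herr := norm_rotor_error_le hσ hnp hnq (hr₁.trans hR) (hr₂.trans hR) rfl rfl
    have hm := hv.sum_modes hσ hε h0 hi hs
    rw [← hp, ← hq] at hm
    have hrot := norm_rotor_le hσ hnp hnq
    rw [← hp, ← hq]
    generalize rotor σ p q = ζ at *
    generalize -Complex.I * (_ : ℂ) + Complex.I * σ * (_ : ℂ) = ζ' at *
    have e : Complex.exp ((-(2 * ε ^ 2) * s : ℝ) * Complex.I)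
          * ((-(2 * ε ^ 2) : ℝ) * Complex.I) * ζ
        + Complex.exp ((-(2 * ε ^ 2) * s : ℝ) * Complex.I) * ζ'
        = Complex.exp ((-(2 * ε ^ 2) * s : ℝ) * Complex.I)
          * ((ζ' - 2 * Complex.I * (‖p‖ ^ 2 + ‖q‖ ^ 2 : ℝ) * ζ)
            + 2 * Complex.I * (‖p‖ ^ 2 + ‖q‖ ^ 2 - ε ^ 2 : ℝ) * ζ) := by
      push_cast; ring
    rw [e, norm_mul, Complex.norm_exp_ofReal_mul_I, one_mul]
    refine (norm_add_le _ _).trans ?_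
    have h2 : ‖2 * Complex.I * (‖p‖ ^ 2 + ‖q‖ ^ 2 - ε ^ 2 : ℝ) * ζ‖
        ≤ 2 * (8 * embConst ^ 2 * ε ^ 4) * (4 * ε ^ 2) := by
      rw [norm_mul, norm_mul, norm_mul, Complex.norm_I, Complex.norm_real, Real.norm_eq_abs,
        Complex.norm_ofNat, mul_one]
      gcongr
    have h3 : ε ^ 6 ≤ ε ^ 5 := pow_le_pow_of_le_one hε0 hε1 (by norm_num)
    have h4 : embConst ^ 2 * ε ^ 6 ≤ embConst ^ 2 * ε ^ 5 := by gcongr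
    rw [beatConst]
    linarith
  choose! w' hw' hw using hderiv
  have hlip := (convex_Icc α β).norm_image_sub_le_of_norm_hasDerivWithin_le hw hw' h0 ht
  simp only [hi, rotor_init, mul_zero, Complex.ofReal_zero, zero_mul, Complex.exp_zero, one_mul,
    sub_zero, Real.norm_eq_abs] at hlip
  obtain ⟨ζ, hζ⟩ : ∃ ζ, ζ = rotor σ (unweight (v t) 1) (unweight (v t) (-1)) := ⟨_, rfl⟩
  rw [← hζ] at hlip
  have him := rotor_im σ (unweight (v t) 1) (unweight (v t) (-1))
  rw [← hζ] at him
  have hσ2 : σ * σ = 1 := by rw [← abs_mul_abs_self, hσ, one_mul]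
  have hE : Complex.exp ((2 * ε ^ 2 * t : ℝ) * Complex.I)
      * Complex.exp ((-(2 * ε ^ 2) * t : ℝ) * Complex.I) = 1 := by
    rw [← Complex.exp_add, ← Complex.exp_zero]; congr 1; push_cast; ring
  have hlip' : ‖ζ - (ε ^ 2 : ℝ) * Complex.exp ((2 * ε ^ 2 * t : ℝ) * Complex.I)‖
      ≤ beatConst * ε ^ 5 * |t| := by
    have e : ζ - (ε ^ 2 : ℝ) * Complex.exp ((2 * ε ^ 2 * t : ℝ) * Complex.I)
        = Complex.exp ((2 * ε ^ 2 * t : ℝ) * Complex.I)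
          * (Complex.exp ((-(2 * ε ^ 2) * t : ℝ) * Complex.I) * ζ - (ε ^ 2 : ℝ)) := by
      linear_combination (-ζ) * hE
    rw [e, norm_mul, Complex.norm_exp_ofReal_mul_I, one_mul]
    exact hlip
  have h5 := (Complex.abs_im_le_norm _).trans hlip'
  rw [Complex.sub_im, him, Complex.im_ofReal_mul, Complex.exp_ofReal_mul_I_im] at h5
  have e : ‖unweight (v t) 1‖ ^ 2 - ‖unweight (v t) (-1)‖ ^ 2
      - σ * (ε ^ 2 * Real.sin (2 * ε ^ 2 * t))
      = σ * (σ * (‖unweight (v t) 1‖ ^ 2 - ‖unweight (v t) (-1)‖ ^ 2)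
        - ε ^ 2 * Real.sin (2 * ε ^ 2 * t)) := by
    linear_combination (-(‖unweight (v t) 1‖ ^ 2 - ‖unweight (v t) (-1)‖ ^ 2)) * hσ2
  rwa [e, abs_mul, hσ, one_mul]

theorem beatConst_nonneg : 0 ≤ beatConst := by
  have h1 := embConst_nonneg
  have h2 := cubConst_nonneg
  rw [beatConst]
  positivity

theorem norm_unweight_freeFlow_wcoeff {u : C(Circ, ℂ)} (h : MemH1 u) (t : ℝ) (k : ℤ) :
    ‖unweight (freeFlow t (wcoeff u)) k‖ = ‖fourierCoeff u k‖ := by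
  rw [unweight_freeFlow, freeFlow_apply, norm_mul, Complex.norm_exp_ofReal_mul_I, one_mul,
    ← fourierCoeff_synth, synth_wcoeff h]

/-- The two estimates on a single solution, with explicit dependence on `t`. -/
theorem IsSolutionOn.modes {J : Set ℝ} {σ ε : ℝ} {ψ : ℝ → C(Circ, ℂ)}
    (hψ : IsSolutionOn J σ ε ψ) (hJ : J.OrdConnected) (h0 : (0 : ℝ) ∈ J) (hσ : |σ| = 1)
    (hε0 : 0 ≤ ε) (hε1 : ε ≤ 1) (hε : (embConst * ε) ^ 2 ≤ 1 / 4) {t : ℝ} (ht : t ∈ J) :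
    |‖fourierCoeff (ψ t) 1‖ ^ 2 + ‖fourierCoeff (ψ t) (-1)‖ ^ 2 - ε ^ 2|
        ≤ 8 * embConst ^ 2 * ε ^ 4 ∧
      |‖fourierCoeff (ψ t) 1‖ ^ 2 - ‖fourierCoeff (ψ t) (-1)‖ ^ 2
        - σ * (ε ^ 2 * Real.sin (2 * ε ^ 2 * t))| ≤ beatConst * ε ^ 5 * |t| := by
  have hv := (hψ.mono (hJ.uIcc_subset h0 ht)).isCurve
  have hi : freeFlow 0 (wcoeff (ψ 0)) = initX ε := by rw [freeFlow_zero, hψ.wcoeff_zero]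
  have e := norm_unweight_freeFlow_wcoeff (hψ.memH1 t ht) t
  rw [← e 1, ← e (-1)]
  exact ⟨hv.sum_modes hσ hε left_mem_uIcc hi right_mem_uIcc,
    hv.diff_modes hσ hε0 hε1 hε left_mem_uIcc hi right_mem_uIcc⟩

end BeatingNLS

end

theorem theorem1 :
    ∃ ε₀ : ℝ, 0 < ε₀ ∧ ∃ C : ℝ, ∀ ε : ℝ, 0 < ε → ε ≤ ε₀ → ∀ σ : ℝ, (σ = 1 ∨ σ = -1) →
      (∃ ψ : ℝ → C(BeatingNLS.Circ, ℂ),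
        BeatingNLS.IsSolutionOn
          (Set.Icc (-(ε ^ (-(9 / 4) : ℝ))) (ε ^ (-(9 / 4) : ℝ))) σ ε ψ) ∧
      ∀ (J : Set ℝ) (ψ : ℝ → C(BeatingNLS.Circ, ℂ)), J.OrdConnected → (0 : ℝ) ∈ J →
        BeatingNLS.IsSolutionOn J σ ε ψ →
        ∀ t ∈ J, |t| ≤ ε ^ (-(9 / 4) : ℝ) →
          |‖fourierCoeff (ψ t) 1‖ ^ 2 + ‖fourierCoeff (ψ t) (-1)‖ ^ 2 - ε ^ 2| ≤ C * ε ^ 3 ∧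
          |‖fourierCoeff (ψ t) 1‖ ^ 2 - ‖fourierCoeff (ψ t) (-1)‖ ^ 2
              - σ * (ε ^ 2 * Real.sin (2 * ε ^ 2 * t))| ≤ C * ε ^ (9 / 4 : ℝ) := by
  have hA := BeatingNLS.embConst_nonneg
  have hB := BeatingNLS.beatConst_nonneg
  refine ⟨1 / (2 * BeatingNLS.embConst + 1), by positivity,
    max (8 * BeatingNLS.embConst ^ 2) BeatingNLS.beatConst, ?_⟩
  intro ε hε0 hε σ hσ
  have hσ' : |σ| = 1 := by rcases hσ with rfl | rfl <;> simp
  rw [le_div_iff₀ (by positivity)] at hε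
  have hε1 : ε ≤ 1 := by nlinarith
  have hε2 : (BeatingNLS.embConst * ε) ^ 2 ≤ 1 / 4 := by
    have h1 : BeatingNLS.embConst * ε ≤ 1 / 2 := by nlinarith
    have h2 : 0 ≤ BeatingNLS.embConst * ε := by positivity
    nlinarith
  refine ⟨?_, ?_⟩
  · obtain ⟨v, hv0, hv⟩ := BeatingNLS.exists_isCurve (T := ε ^ (-(9 / 4) : ℝ)) hσ' hε0
      hε2 (by positivity)
    exact ⟨_, hv.isSolutionOn hv0⟩
  · intro J ψ hJ h0 hψ t ht htT
    obtain ⟨h1, h2⟩ := hψ.modes hJ h0 hσ' hε0.le hε1 hε2 ht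
    refine ⟨h1.trans ?_, h2.trans ?_⟩
    · have h3 : ε ^ 4 ≤ ε ^ 3 := pow_le_pow_of_le_one hε0.le hε1 (by norm_num)
      gcongr
      exact le_max_left _ _
    · have h3 : ε ^ 5 * ε ^ (-(9 / 4) : ℝ) ≤ ε ^ (9 / 4 : ℝ) := by
        rw [← Real.rpow_natCast, ← Real.rpow_add hε0]
        exact Real.rpow_le_rpow_of_exponent_ge hε0 hε1 (by norm_num)
      calc BeatingNLS.beatConst * ε ^ 5 * |t|
          ≤ BeatingNLS.beatConst * ε ^ 5 * ε ^ (-(9 / 4) : ℝ) := by gcongr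
        _ = BeatingNLS.beatConst * (ε ^ 5 * ε ^ (-(9 / 4) : ℝ)) := by ring
        _ ≤ max (8 * BeatingNLS.embConst ^ 2) BeatingNLS.beatConst * ε ^ (9 / 4 : ℝ) := by
          gcongr
          exact le_max_right _ _
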